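/- Let $\mathbb{D}$ be the open unit disc, $\partial_z=\frac12(\partial_x-i\partial_y)$, $\partial_{\bar z}=\frac12(\partial_x+i\partial_y)$. For real $\alpha,\beta$, a function $u:\mathbb{D}\to\mathbb{C}$ is called $(\alpha,\beta)$-harmonic if it is twice continuously differentiable in $\mathbb{D}$ and $$(1-|z|^2)\bigl((1-|z|^2)\partial_z\partial_{\bar z}u+\alpha z\,\partial_z u+\beta\bar z\,\partial_{\bar z}u-\alpha\beta u\bigr)=0\quad\text{in }\mathbb{D}.$$ Such a function has a series expansion, convergent for all $z\in\mathbb{D}$, $$u(z)=\sum_{k\ge 0}c_kF(-\alpha,k-\beta;k+1;|z|^2)z^k+\sum_{k\ge 1}c_{-k}F(-\beta,k-\alpha;k+1;|z|^2)\bar z^k,\qquad(*)$$ with $c_k\in\mathbb{C}$, where $F$ is the Gaussian hypergeometric function. Let $H^1_G(\mathbb{D})$ be the space of measurable functions $v:\mathbb{D}\to\mathbb{C}$ for which the means $\frac1{2\pi}\int_0^{2\pi}|v(re^{i\theta})|\,d\theta$ exist for all $r\in(0,1)$ and are bounded in $r$. **Theorem.** Let $\alpha$ be a positive integer and $\beta$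 a real number such that $-1<\alpha+\beta<0$. Let $u$ be an $(\alpha,\beta)$-harmonic function such that $\partial_z u\in H_G^1(\mathbb{D})$ or $\partial_{\bar z}u\in H^1_G(\mathbb{D})$. Then $u$ has an expansion $(*)$, and in every such expansion $c_{-n}=0$ for all $n>\alpha$. Moreover $u$ is $(\alpha+1)$-harmonic, that is, $\Delta^{\alpha+1}u=0$ in $\mathbb{D}$ with $\Delta$ the usual Laplacian (and $u$ is $2(\alpha+1)$ times continuously differentiable there), and $$u(z)=K_0(z)+K_1(z)|z|^2+\dots+K_\alpha(z)|z|^{2\alpha},\qquad z\in\mathbb{D},$$ where $K_i=h_i+\overline{g_i}$ with $h_i$ analytic in $\mathbb{D}$ and $g_i$ a polynomial for $i=0,\dots,\alpha-1$, and $K_\alpha$ is analytic in $\mathbb{D}$. -/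

import Mathlib

noncomputable section

/-- The open unit disc of the complex plane. -/
def unitDisc : Set ℂ := Metric.ball 0 1

/-- The Wirtinger derivative `∂_z = (∂_x - i ∂_y) / 2`. -/
def dz (u : ℂ → ℂ) (z : ℂ) : ℂ :=
  (1 / 2 : ℂ) * (fderiv ℝ u z 1 - Complex.I * fderiv ℝ u z Complex.I)

/-- The Wirtinger derivative `∂_{z̄} = (∂_x + i ∂_y) / 2`. -/
def dzbar (u : ℂ → ℂ) (z : ℂ) : ℂ :=
  (1 / 2 : ℂ) * (fderiv ℝ u z 1 + Complex.I * fderiv ℝ u z Complex.I)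

/-- The operator
`Δ_{α,β} = (1 - |z|²) ((1 - |z|²) ∂_z ∂_{z̄} + α z ∂_z + β z̄ ∂_{z̄} - α β)`. -/
def weightedLaplacian (α β : ℝ) (u : ℂ → ℂ) (z : ℂ) : ℂ :=
  (1 - (‖z‖ : ℂ) ^ 2) *
    ((1 - (‖z‖ : ℂ) ^ 2) * dz (dzbar u) z + (α : ℂ) * z * dz u z
      + (β : ℂ) * (starRingEnd ℂ) z * dzbar u z - (α : ℂ) * (β : ℂ) * u z)

/-- `u` is `(α, β)`-harmonic: twice continuously differentiable on the unit disc, where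
`Δ_{α,β} u = 0`. Values of `u` outside the disc play no role. -/
def IsABHarmonic (α β : ℝ) (u : ℂ → ℂ) : Prop :=
  ContDiffOn ℝ 2 u unitDisc ∧ ∀ z ∈ unitDisc, weightedLaplacian α β u z = 0

/-- The integral mean `M_p(r, v)`, for `0 < p < ∞`. -/
def integralMean (p r : ℝ) (v : ℂ → ℂ) : ℝ :=
  ((2 * Real.pi)⁻¹ * ∫ θ in (0 : ℝ)..(2 * Real.pi),
    ‖v ((r : ℂ) * Complex.exp ((θ : ℂ) * Complex.I))‖ ^ p) ^ (1 / p)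

/-- Membership in the generalized Hardy space `H_G^p` of the disc, for `0 < p < ∞`: `v` is
(Lebesgue) measurable on the disc, all the integral means exist, and they are bounded. -/
def MemHG (p : ℝ) (v : ℂ → ℂ) : Prop :=
  AEMeasurable v (MeasureTheory.volume.restrict unitDisc) ∧
  (∀ r ∈ Set.Ioo (0 : ℝ) 1, IntervalIntegrable
    (fun θ : ℝ => ‖v ((r : ℂ) * Complex.exp ((θ : ℂ) * Complex.I))‖ ^ p)
    MeasureTheory.volume 0 (2 * Real.pi)) ∧
  BddAbove ((fun r : ℝ => integralMean p r v) '' Set.Ioo (0 : ℝ) 1)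

/-- The term `c_k F(-α, k - β; k + 1; |z|²) z^k`, for `k ≥ 0`. -/
def posTerm (α β : ℝ) (c : ℤ → ℂ) (k : ℕ) (z : ℂ) : ℂ :=
  c (k : ℤ) *
    ((ordinaryHypergeometric (-α) ((k : ℝ) - β) ((k : ℝ) + 1) (‖z‖ ^ 2) : ℝ) : ℂ) * z ^ k

/-- The term `c_{-k} F(-β, k - α; k + 1; |z|²) z̄^k`, for `k ≥ 1`. -/
def negTerm (α β : ℝ) (c : ℤ → ℂ) (k : ℕ) (z : ℂ) : ℂ :=
  c (-(k : ℤ)) *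
    ((ordinaryHypergeometric (-β) ((k : ℝ) - α) ((k : ℝ) + 1) (‖z‖ ^ 2) : ℝ) : ℂ)
      * (starRingEnd ℂ) z ^ k

/-- `c` is a family of coefficients of the homogeneous series expansion of `u`: on the unit disc,
`u(z) = ∑_{k ≥ 0} c_k F(-α, k - β; k + 1; |z|²) z^k
  + ∑_{k ≥ 1} c_{-k} F(-β, k - α; k + 1; |z|²) z̄^k`, both series being convergent. -/
def HasExpansion (α β : ℝ) (u : ℂ → ℂ) (c : ℤ → ℂ) : Prop :=
  ∀ z ∈ unitDisc,
    Summable (fun k : ℕ => posTerm α β c k z) ∧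
    Summable (fun k : ℕ => negTerm α β c (k + 1) z) ∧
    u z = ∑' k : ℕ, posTerm α β c k z + ∑' k : ℕ, negTerm α β c (k + 1) z

/-- `u` is `n`-harmonic on the unit disc: it has continuous derivatives up to order `2 n` there,
and the `n`-th iterate of the Laplacian annihilates it. -/
def IsPolyharmonic (n : ℕ) (u : ℂ → ℂ) : Prop :=
  ContDiffOn ℝ ((2 * n : ℕ) : WithTop ℕ∞) u unitDisc ∧
  ∀ z ∈ unitDisc, ((fun w : ℂ → ℂ => Laplacian.laplacian w)^[n] u) z = 0

end

/-! Let `f_n(r)` be the `n`-th Fourier coefficient of `u` on the circle of radius `r`. The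
differential equation for `u` turns into a first-order linear system for `f_n` and the `(n+1)`-th
coefficient of `∂_z̄ u` (`IsABHarmonic.radialSystem`). Its solutions regular at the origin form a
line, by the Wronskian, and the hypergeometric term of index `n` spans it; hence `f_n = c_n *
radialSol n`. Since `u` is C², its Fourier series converges absolutely, which is the expansion
(`IsABHarmonic.exists_hasExpansion`). Conversely, termwise integration recovers the coefficients of
any expansion (`HasExpansion.fcoef_eq`).

Fourier coefficients of `∂_z u` and `∂_z̄ u` are bounded by their integral means. For index `-n`
with `n > α`, both coefficients dominate `|c_{-n}| r^{n+1} F'(r²)`, where `F = F(-β, n-α; n+1; ·)`.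
Its upper parameters are positive and their sum exceeds `n` because `α + β < 0`; the Taylor
coefficients of `F'` therefore dominate a harmonic series and `F'` is unbounded near 1. So `c_{-n} =
0` (`HasExpansion.coeff_neg_eq_zero`).

What remains has only polynomial hypergeometric factors: degree at most `α` for the terms in `z^k`,
at most `α - k` for those in `z̄^k`. Since `|z|^{2i} z̄^k = z^i z̄^{i+k}` with `i + k ≤ α`, `u` is a
polynomial of degree at most `α` in `z̄` with analytic coefficients, and each Laplacian `4 ∂_z ∂_z̄`
lowers that degree. Collecting powers of `|z|²` requires convergence of each coefficient series
separately; it holds because `F(-α, k-β; k+1; x)` tends to `(1-x)^α ≠ 0` as `k → ∞`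
(`HasExpansion.summable_coeff`). -/

open Filter Topology

/-! ### Real power series on `(-1, 1)` and their derivatives. -/

/-- The sum of the real power series with coefficients `A`. -/
noncomputable def powerSum (A : ℕ → ℝ) (x : ℝ) : ℝ := ∑' n, A n * x ^ n

/-- The coefficients of the termwise derivative of a power series. -/
def derivCoeff (A : ℕ → ℝ) (n : ℕ) : ℝ := (n + 1) * A (n + 1)

/-- The power series with coefficients `A` converges on `(-1, 1)`. -/
def ConvergesOnUnit (A : ℕ → ℝ) : Prop := ∀ x : ℝ, |x| < 1 → Summable fun n => A n * x ^ n

lemma ConvergesOnUnit.summable_derivCoeff_abs {A : ℕ → ℝ} (hA : ConvergesOnUnit A) {x : ℝ}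
    (hx : |x| < 1) : Summable fun n => ‖derivCoeff A n * x ^ n‖ := by
  obtain ⟨ρ, hxρ, hρ⟩ := exists_between hx
  have hρ0 : 0 < ρ := (abs_nonneg x).trans_lt hxρ
  have h1 := (hA ρ (by rwa [abs_of_pos hρ0])).tendsto_atTop_zero
  obtain ⟨C, hC⟩ := h1.norm.bddAbove_range
  have hC' : ∀ n, |A n| * ρ ^ n ≤ C := fun n => by
    have := hC ⟨n, rfl⟩
    simpa [abs_mul, abs_of_pos hρ0] using this
  have hq : ‖|x| / ρ‖ < 1 := by
    rw [Real.norm_of_nonneg (by positivity), div_lt_one hρ0]; exact hxρ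
  -- Boundedness of `A n * ρ ^ n` at a radius `ρ` beyond `|x|` leaves a geometric factor that
  -- absorbs `n + 1`.
  have h2 : Summable fun n : ℕ => C / ρ * ((n + 1 : ℝ) * (|x| / ρ) ^ n) := by
    apply Summable.mul_left
    have h3 := (summable_pow_mul_geometric_of_norm_lt_one 1 hq).add
      (summable_geometric_of_norm_lt_one hq)
    refine h3.congr fun n => by ring
  refine Summable.of_nonneg_of_le (fun _ => norm_nonneg _) (fun n => ?_) h2
  have h4 := hC' (n + 1)
  have h5 : |A (n + 1)| * ρ ^ n ≤ C / ρ := by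
    rw [le_div_iff₀ hρ0]; calc _ = _ := by ring
      _ ≤ C := h4
  rw [derivCoeff, norm_mul, norm_mul, norm_pow, Real.norm_of_nonneg (by positivity : (0 : ℝ) ≤ n + 1),
    Real.norm_eq_abs, Real.norm_eq_abs, div_pow]
  calc (n + 1 : ℝ) * |A (n + 1)| * |x| ^ n
      = (|A (n + 1)| * ρ ^ n) * ((n + 1 : ℝ) * (|x| ^ n / ρ ^ n)) := by field_simp
    _ ≤ _ := by gcongr

lemma ConvergesOnUnit.derivCoeff {A : ℕ → ℝ} (hA : ConvergesOnUnit A) :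
    ConvergesOnUnit (derivCoeff A) :=
  fun _ hx => (hA.summable_derivCoeff_abs hx).of_norm

lemma ConvergesOnUnit.hasDerivAt {A : ℕ → ℝ} (hA : ConvergesOnUnit A) {x : ℝ} (hx : |x| < 1) :
    HasDerivAt (powerSum A) (powerSum (_root_.derivCoeff A) x) x := by
  obtain ⟨ρ, hxρ, hρ⟩ := exists_between hx
  have hρ0 : 0 < ρ := (abs_nonneg x).trans_lt hxρ
  have hu : Summable fun n : ℕ => |A n| * (n * ρ ^ (n - 1)) := by
    rw [← summable_nat_add_iff 1]
    refine (hA.summable_derivCoeff_abs (x := ρ) (by rwa [abs_of_pos hρ0])).congr fun n => ?_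
    rw [_root_.derivCoeff, norm_mul, norm_mul, norm_pow,
      Real.norm_of_nonneg (by positivity : (0 : ℝ) ≤ n + 1), Real.norm_of_nonneg hρ0.le,
      Real.norm_eq_abs]
    simp; ring
  have hb : ∀ n y, y ∈ Metric.ball (0 : ℝ) ρ → ‖A n * (n * y ^ (n - 1))‖ ≤
      |A n| * (n * ρ ^ (n - 1)) := by
    intro n y hy
    have hy' : |y| ≤ ρ := by simpa using (mem_ball_zero_iff.1 hy).le
    rw [norm_mul, norm_mul, norm_pow, Real.norm_eq_abs, Real.norm_eq_abs, Real.norm_eq_abs,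
      Nat.abs_cast]
    gcongr
  have hxm : x ∈ Metric.ball (0 : ℝ) ρ := by simpa using hxρ
  have h := hasDerivAt_tsum_of_isPreconnected (g := fun n y => A n * y ^ n)
    (g' := fun n y => A n * (n * y ^ (n - 1))) hu Metric.isOpen_ball
    (convex_ball (0 : ℝ) ρ).isPreconnected
    (fun n y _ => (hasDerivAt_pow n y).const_mul (A n)) hb hxm (hA x hx) hxm
  have hs : Summable fun n : ℕ => A n * (n * x ^ (n - 1)) :=
    Summable.of_norm_bounded hu fun n => hb n x hxm
  refine h.congr_deriv ?_
  rw [hs.tsum_eq_zero_add, powerSum]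
  simp only [CharP.cast_eq_zero, zero_mul, mul_zero, zero_add]
  refine tsum_congr fun n => ?_
  rw [_root_.derivCoeff]; push_cast; ring

lemma powerSum_zero (A : ℕ → ℝ) : powerSum A 0 = A 0 := by
  rw [powerSum, tsum_eq_single 0 (fun n hn => by simp [hn])]; simp

/-! ### The hypergeometric series: recurrence, differential equation, growth at 1. -/

lemma ordinaryHypergeometric_eq_powerSum (a b c x : ℝ) :
    ordinaryHypergeometric a b c x = powerSum (ordinaryHypergeometricCoefficient a b c) x := by
  rw [ordinaryHypergeometric_eq_tsum]; rfl

lemma ordinaryHypergeometricCoefficient_zero (a b c : ℝ) :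
    ordinaryHypergeometricCoefficient a b c 0 = 1 := by
  simp [ordinaryHypergeometricCoefficient]

lemma ordinaryHypergeometricCoefficient_succ (a b : ℝ) {c : ℝ} (hc : 0 < c) (n : ℕ) :
    (n + 1) * (c + n) * ordinaryHypergeometricCoefficient a b c (n + 1) =
      (a + n) * (b + n) * ordinaryHypergeometricCoefficient a b c n := by
  have h1 : (ascPochhammer ℝ n).eval c ≠ 0 := (ascPochhammer_pos n c hc).ne'
  have h2 : c + n ≠ 0 := by positivity
  have h3 : (n.factorial : ℝ) ≠ 0 := by positivity
  simp only [ordinaryHypergeometricCoefficient, ascPochhammer_succ_eval, Nat.factorial_succ]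
  push_cast
  field_simp

/-- The radius is 1, except when an upper parameter is a nonpositive integer: the series then
terminates and the radius is infinite. -/
lemma convergesOnUnit_ordinaryHypergeometric (a b : ℝ) {c : ℝ} (hc : 0 < c) :
    ConvergesOnUnit (ordinaryHypergeometricCoefficient a b c) := by
  intro x hx
  have hr : 1 ≤ (ordinaryHypergeometricSeries ℝ a b c).radius := by
    by_cases ha : ∃ k : ℕ, (k : ℝ) = -a
    · obtain ⟨k, hk⟩ := ha
      obtain rfl : a = -k := by linarith
      rw [ordinaryHypergeometric_radius_top_of_neg_nat₁]; exact le_top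
    by_cases hb : ∃ k : ℕ, (k : ℝ) = -b
    · obtain ⟨k, hk⟩ := hb
      obtain rfl : b = -k := by linarith
      rw [ordinaryHypergeometric_radius_top_of_neg_nat₂]; exact le_top
    push Not at ha hb
    refine (ordinaryHypergeometricSeries_radius_eq_one ℝ a b c fun k => ⟨ha k, hb k, ?_⟩).ge
    have : (0 : ℝ) ≤ k := k.cast_nonneg
    intro h; linarith
  have hx' : x ∈ Metric.eball (0 : ℝ) (ordinaryHypergeometricSeries ℝ a b c).radius := by
    refine Metric.eball_subset_eball hr ?_
    rw [Metric.mem_eball, edist_zero_right, ← ofReal_norm, ENNReal.ofReal_lt_one]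
    exact hx
  have := (ordinaryHypergeometricSeries ℝ a b c).summable hx'
  rw [ordinaryHypergeometricSeries_apply_eq'] at this
  exact this

/-- The Gauss hypergeometric differential equation. -/
lemma hypergeometric_ode (a b : ℝ) {c : ℝ} (hc : 0 < c) {x : ℝ} (hx : |x| < 1) :
    let A := ordinaryHypergeometricCoefficient a b c
    x * (1 - x) * powerSum (derivCoeff (derivCoeff A)) x
      + (c - (a + b + 1) * x) * powerSum (derivCoeff A) x - a * b * powerSum A x = 0 := by
  intro A
  have hA : ConvergesOnUnit A := convergesOnUnit_ordinaryHypergeometric a b hc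
  have h0 := (hA x hx).hasSum
  have h1 := (hA.derivCoeff x hx).hasSum
  have h2 := (hA.derivCoeff.derivCoeff x hx).hasSum
  -- The series for `x F'`, `x F''` and `x² F''` are reindexed by the exponent of `x`, so that the
  -- `n`-th coefficient of the equation is the recurrence.
  have hx1 : HasSum (fun n : ℕ => n * A n * x ^ n) (x * powerSum (derivCoeff A) x) := by
    rw [← hasSum_nat_add_iff' 1]
    simp only [Finset.range_one, Finset.sum_singleton, CharP.cast_eq_zero, zero_mul, sub_zero]
    refine (h1.mul_left x).congr_fun fun n => ?_
    simp only [derivCoeff]; push_cast; ring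
  have hx2 : HasSum (fun n : ℕ => (n + 1) * n * A (n + 1) * x ^ n)
      (x * powerSum (derivCoeff (derivCoeff A)) x) := by
    rw [← hasSum_nat_add_iff' 1]
    simp only [Finset.range_one, Finset.sum_singleton, CharP.cast_eq_zero, zero_mul, mul_zero,
      sub_zero]
    refine (h2.mul_left x).congr_fun fun n => ?_
    simp only [derivCoeff]; push_cast; ring
  have hx3 : HasSum (fun n : ℕ => (n : ℝ) * (n - 1) * A n * x ^ n)
      (x * (x * powerSum (derivCoeff (derivCoeff A)) x)) := by
    rw [← hasSum_nat_add_iff' 1]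
    simp only [Finset.range_one, Finset.sum_singleton, CharP.cast_eq_zero, zero_mul, sub_zero]
    refine (hx2.mul_left x).congr_fun fun n => ?_
    push_cast; ring
  have hs := (((hx2.sub hx3).add (h1.mul_left c)).sub (hx1.mul_left (a + b + 1))).sub
    (h0.mul_left (a * b))
  have hz : HasSum (fun _ : ℕ => (0 : ℝ)) _ := hs.congr_fun fun n => by
    have := ordinaryHypergeometricCoefficient_succ a b hc n
    change _ = ((n + 1) * n * A (n + 1) * x ^ n - n * (n - 1) * A n * x ^ n +
      c * (derivCoeff A n * x ^ n)) - (a + b + 1) * (n * A n * x ^ n) - a * b * (A n * x ^ n)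
    simp only [derivCoeff]
    linear_combination (-x ^ n) * this
  have := hz.unique hasSum_zero
  simp only [powerSum] at this ⊢
  linear_combination this

lemma ordinaryHypergeometricCoefficient_pos {a b c : ℝ} (ha : 0 < a) (hb : 0 < b) (hc : 0 < c)
    (n : ℕ) : 0 < ordinaryHypergeometricCoefficient a b c n := by
  have := ascPochhammer_pos n a ha
  have := ascPochhammer_pos n b hb
  have := ascPochhammer_pos n c hc
  simp only [ordinaryHypergeometricCoefficient]; positivity

/-- The quantity `(n + 1)² A (n + 1)` is nondecreasing in `n`: by the recurrence its increment is a
positive multiple of a polynomial in `n` whose coefficients are nonnegative once `c - 1 ≤ a + b`. -/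
lemma derivCoeff_hypergeometric_ge {a b c : ℝ} (ha : 0 < a) (hb : 0 < b) (hc : 1 ≤ c)
    (habc : c - 1 ≤ a + b) (n : ℕ) :
    ordinaryHypergeometricCoefficient a b c 1 / (n + 1) ≤
      derivCoeff (ordinaryHypergeometricCoefficient a b c) n := by
  have hc0 : 0 < c := by linarith
  induction n with
  | zero => simp [derivCoeff]
  | succ n ih =>
    have h1 := ordinaryHypergeometricCoefficient_succ a b hc0 (n + 1)
    have hp := ordinaryHypergeometricCoefficient_pos ha hb hc0 (n + 1)
    rw [div_le_iff₀ (by positivity)] at ih ⊢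
    refine ih.trans ?_
    simp only [derivCoeff]
    set X := ordinaryHypergeometricCoefficient a b c (n + 1)
    set Y := ordinaryHypergeometricCoefficient a b c (n + 1 + 1)
    push_cast at h1 ⊢
    have hd : 0 < c + (n + 1) := by positivity
    refine le_of_mul_le_mul_left ?_ hd
    have e : (c + (n + 1)) * ((n + 1 + 1) * Y * (n + 1 + 1))
      = (n + 1 + 1) * ((a + (n + 1)) * (b + (n + 1)) * X) := by rw [← h1]; ring
    rw [e, ← sub_nonneg]
    have e2 : (n + 1 + 1) * ((a + (n + 1)) * (b + (n + 1)) * X)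
        - (c + (n + 1)) * ((n + 1) * X * (n + 1))
      = X * ((a + b - (c - 1)) * (n + 1) * (n + 2) + a * b * (n + 2)
        + (c - 1) * (n + 1)) := by ring
    rw [e2]
    have : 0 ≤ a + b - (c - 1) := by linarith
    have : 0 ≤ c - 1 := by linarith
    positivity

lemma powerSum_nonneg {A : ℕ → ℝ} (hA : ∀ n, 0 ≤ A n) {x : ℝ} (hx : 0 ≤ x) : 0 ≤ powerSum A x :=
  tsum_nonneg fun n => mul_nonneg (hA n) (pow_nonneg hx n)

/-- A power series whose coefficients dominate a harmonic series is unbounded on `(0, 1)`. -/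
lemma not_bounded_powerSum_of_harmonic_le {A : ℕ → ℝ} (hA : ConvergesOnUnit A) {d : ℝ} (hd : 0 < d)
    (h : ∀ n : ℕ, d / (n + 1) ≤ A n) (B : ℝ) : ∃ x0 ∈ Set.Ioo (0 : ℝ) 1,
      ∀ x ∈ Set.Ioo x0 1, B < powerSum A x := by
  have hlim := (tendsto_atTop.1 (Real.tendsto_sum_range_one_div_nat_succ_atTop)) ((B + 1) / d)
  obtain ⟨N, hN⟩ := hlim.exists
  have hpos : ∀ n, 0 ≤ A n := fun n => le_trans (by positivity) (h n)
  -- A partial sum exceeding `B` at `x = 1` still does so just to the left of 1, and the omitted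
  -- terms are nonnegative.
  have hcont : Tendsto (fun x : ℝ => ∑ n ∈ Finset.range N, A n * x ^ n) (𝓝[<] 1)
      (𝓝 (∑ n ∈ Finset.range N, A n * 1 ^ n)) :=
    Tendsto.mono_left (Continuous.tendsto (by fun_prop) 1) nhdsWithin_le_nhds
  have hB : B < ∑ n ∈ Finset.range N, A n * 1 ^ n := by
    calc B < B + 1 := by linarith
      _ ≤ d * ∑ n ∈ Finset.range N, (1 : ℝ) / (n + 1) := by rwa [div_le_iff₀' hd] at hN
      _ ≤ _ := by
        rw [Finset.mul_sum]
        refine Finset.sum_le_sum fun n _ => ?_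
        simpa [div_eq_mul_inv] using h n
  have hev := (hcont.eventually (lt_mem_nhds hB)).and
    (Ioo_mem_nhdsLT (show (0 : ℝ) < 1 by norm_num))
  obtain ⟨l, hl, hl'⟩ := (mem_nhdsLT_iff_exists_Ioo_subset).1 hev
  refine ⟨max l (1 / 2), ⟨by positivity, max_lt hl (by norm_num)⟩, fun x hx => ?_⟩
  have hxl : x ∈ Set.Ioo l 1 := ⟨(le_max_left _ _).trans_lt hx.1, hx.2⟩
  have hx0 := (hl' hxl).2.1
  refine (hl' hxl).1.trans_le ?_
  exact (hA x (by rw [abs_of_pos hx0]; exact hx.2)).sum_le_tsum _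
    fun n _ => mul_nonneg (hpos n) (pow_nonneg hx0.le n)

/-! ### Fourier coefficients on circles. -/

/-- The `n`-th Fourier coefficient of the restriction of `u` to the circle of radius `r`. -/
noncomputable def fcoef (n : ℤ) (u : ℂ → ℂ) (r : ℝ) : ℂ :=
  (2 * Real.pi : ℂ)⁻¹ * ∫ θ in (0 : ℝ)..(2 * Real.pi),
    u (r * Complex.exp (θ * Complex.I)) * Complex.exp (-(n * θ * Complex.I))

lemma isOpen_unitDisc : IsOpen unitDisc := Metric.isOpen_ball

lemma norm_ofReal_mul_exp (r θ : ℝ) : ‖(r : ℂ) * Complex.exp (θ * Complex.I)‖ = |r| := by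
  rw [norm_mul, Complex.norm_exp_ofReal_mul_I, mul_one, Complex.norm_real, Real.norm_eq_abs]

lemma norm_exp_neg_int_mul (n : ℤ) (θ : ℝ) : ‖Complex.exp (-(n * θ * Complex.I))‖ = 1 := by
  rw [show -((n : ℂ) * θ * Complex.I) = ((-(n * θ) : ℝ) : ℂ) * Complex.I by push_cast; ring,
    Complex.norm_exp_ofReal_mul_I]

lemma ofReal_mul_exp_mem_unitDisc {r : ℝ} (hr : |r| < 1) (θ : ℝ) :
    (r : ℂ) * Complex.exp (θ * Complex.I) ∈ unitDisc := by
  rw [unitDisc, mem_ball_zero_iff, norm_ofReal_mul_exp]; exact hr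

lemma continuous_comp_circle {u : ℂ → ℂ} (hu : ContinuousOn u unitDisc) {r : ℝ} (hr : |r| < 1) :
    Continuous fun θ : ℝ => u (r * Complex.exp (θ * Complex.I)) :=
  hu.comp_continuous (by fun_prop) (ofReal_mul_exp_mem_unitDisc hr)

lemma continuous_fcoef_integrand {u : ℂ → ℂ} (hu : ContinuousOn u unitDisc) (n : ℤ) {r : ℝ}
    (hr : |r| < 1) : Continuous fun θ : ℝ =>
      u (r * Complex.exp (θ * Complex.I)) * Complex.exp (-(n * θ * Complex.I)) :=
  (continuous_comp_circle hu hr).mul (by fun_prop)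

lemma fcoef_congr {u v : ℂ → ℂ} (h : ∀ z ∈ unitDisc, u z = v z) (n : ℤ) {r : ℝ} (hr : |r| < 1) :
    fcoef n u r = fcoef n v r := by
  simp only [fcoef]
  congr 2
  ext θ
  rw [h _ (ofReal_mul_exp_mem_unitDisc hr θ)]

lemma fcoef_add {u v : ℂ → ℂ} (hu : ContinuousOn u unitDisc) (hv : ContinuousOn v unitDisc)
    (n : ℤ) {r : ℝ} (hr : |r| < 1) :
    fcoef n (fun z => u z + v z) r = fcoef n u r + fcoef n v r := by
  simp only [fcoef, add_mul]
  rw [intervalIntegral.integral_add, mul_add]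
  · exact (continuous_fcoef_integrand hu n hr).intervalIntegrable _ _
  · exact (continuous_fcoef_integrand hv n hr).intervalIntegrable _ _

lemma fcoef_const_mul (a : ℂ) (u : ℂ → ℂ) (n : ℤ) (r : ℝ) :
    fcoef n (fun z => a * u z) r = a * fcoef n u r := by
  simp only [fcoef, mul_assoc a]
  rw [intervalIntegral.integral_const_mul]; ring

lemma fcoef_id_mul (u : ℂ → ℂ) (n : ℤ) (r : ℝ) :
    fcoef n (fun z => z * u z) r = r * fcoef (n - 1) u r := by
  simp only [fcoef]
  rw [mul_left_comm, ← intervalIntegral.integral_const_mul (r : ℂ)]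
  refine congrArg _ (congrArg (fun h : ℝ → ℂ => ∫ θ in (0 : ℝ)..(2 * Real.pi), h θ) ?_)
  ext1 θ
  have : Complex.exp (-(((n - 1 : ℤ) : ℂ) * θ * Complex.I)) =
      Complex.exp (θ * Complex.I) * Complex.exp (-(n * θ * Complex.I)) := by
    rw [← Complex.exp_add]; push_cast; ring_nf
  rw [this]; ring

lemma conj_exp_ofReal_mul_I (θ : ℝ) : (starRingEnd ℂ) (Complex.exp (θ * Complex.I)) =
    Complex.exp (-(θ * Complex.I)) := by
  rw [← Complex.exp_conj]; simp

lemma fcoef_conj_mul (u : ℂ → ℂ) (n : ℤ) (r : ℝ) :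
    fcoef n (fun z => (starRingEnd ℂ) z * u z) r = r * fcoef (n + 1) u r := by
  simp only [fcoef]
  rw [mul_left_comm, ← intervalIntegral.integral_const_mul (r : ℂ)]
  refine congrArg _ (congrArg (fun h : ℝ → ℂ => ∫ θ in (0 : ℝ)..(2 * Real.pi), h θ) ?_)
  ext1 θ
  have : Complex.exp (-(((n + 1 : ℤ) : ℂ) * θ * Complex.I)) =
      Complex.exp (-(θ * Complex.I)) * Complex.exp (-(n * θ * Complex.I)) := by
    rw [← Complex.exp_add]; push_cast; ring_nf
  rw [this, map_mul, conj_exp_ofReal_mul_I, Complex.conj_ofReal]; ring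

lemma fcoef_radial_mul (g : ℝ → ℂ) (u : ℂ → ℂ) (n : ℤ) (r : ℝ) :
    fcoef n (fun z => g ‖z‖ * u z) r = g |r| * fcoef n u r := by
  rw [← fcoef_const_mul]
  simp only [fcoef, norm_ofReal_mul_exp]

lemma norm_fcoef_le {u : ℂ → ℂ} {r C : ℝ} (n : ℤ) (h : ∀ z, ‖z‖ = |r| → ‖u z‖ ≤ C) :
    ‖fcoef n u r‖ ≤ C := by
  have hpi := Real.pi_pos
  have h1 : ‖∫ θ in (0 : ℝ)..(2 * Real.pi),
    u (r * Complex.exp (θ * Complex.I)) * Complex.exp (-(n * θ * Complex.I))‖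
      ≤ C * |2 * Real.pi - 0| := by
    refine intervalIntegral.norm_integral_le_of_norm_le_const fun θ _ => ?_
    rw [norm_mul, norm_exp_neg_int_mul, mul_one]
    exact h _ (norm_ofReal_mul_exp r θ)
  rw [fcoef, norm_mul, norm_inv]
  have h2 : ‖(2 * Real.pi : ℂ)‖ = 2 * Real.pi := by
    rw [norm_mul, Complex.norm_real, Real.norm_of_nonneg hpi.le]; simp
  rw [h2, inv_mul_le_iff₀ (by positivity)]
  rw [sub_zero, abs_of_pos (by positivity)] at h1
  linarith

/-- This is the only way in which membership in `H_G^1` is used. -/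
lemma norm_fcoef_le_integralMean (u : ℂ → ℂ) (n : ℤ) (r : ℝ) :
    ‖fcoef n u r‖ ≤ integralMean 1 r u := by
  have hpi := Real.pi_pos
  rw [fcoef, integralMean, norm_mul, norm_inv]
  have h2 : ‖(2 * Real.pi : ℂ)‖ = 2 * Real.pi := by
    rw [norm_mul, Complex.norm_real, Real.norm_of_nonneg hpi.le]; simp
  rw [h2, one_div_one, Real.rpow_one]
  gcongr
  refine (intervalIntegral.norm_integral_le_integral_norm (by positivity)).trans_eq ?_
  congr 1
  ext θ
  rw [norm_mul, norm_exp_neg_int_mul, mul_one, Real.rpow_one]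

/-! ### Wirtinger derivatives and Fourier coefficients. -/

lemma fderiv_eq_wirtinger (u : ℂ → ℂ) (z w : ℂ) :
    fderiv ℝ u z w = w * dz u z + (starRingEnd ℂ) w * dzbar u z := by
  have h : w = w.re • (1 : ℂ) + w.im • Complex.I := by simp
  have h1 : fderiv ℝ u z w = w.re * fderiv ℝ u z 1 + w.im * fderiv ℝ u z Complex.I := by
    conv_lhs => rw [h, map_add, map_smul, map_smul]
    simp
  have h2 : (starRingEnd ℂ) w = w.re - w.im * Complex.I := by
    apply Complex.ext <;> simp
  have h3 : w = w.re + w.im * Complex.I := (Complex.re_add_im w).symm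
  rw [h1, h2, dz, dzbar]
  generalize fderiv ℝ u z 1 = a
  generalize fderiv ℝ u z Complex.I = b
  have hI := Complex.I_mul_I
  conv_rhs => rw [h3]
  simp only [Complex.add_re, Complex.ofReal_re, Complex.mul_re, Complex.ofReal_im, Complex.I_re,
    Complex.I_im, Complex.add_im, Complex.mul_im]
  push_cast
  ring_nf
  rw [Complex.I_sq]; ring

lemma contDiffOn_fderiv_apply {u : ℂ → ℂ} {m : ℕ} (hu : ContDiffOn ℝ (m + 1) u unitDisc) (w : ℂ) :
    ContDiffOn ℝ m (fun z => fderiv ℝ u z w) unitDisc :=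
  (hu.fderiv_of_isOpen isOpen_unitDisc le_rfl).clm_apply contDiffOn_const

lemma contDiffOn_dz {u : ℂ → ℂ} {m : ℕ} (hu : ContDiffOn ℝ (m + 1) u unitDisc) :
    ContDiffOn ℝ m (dz u) unitDisc := by
  unfold dz
  exact contDiffOn_const.mul ((contDiffOn_fderiv_apply hu 1).sub
    (contDiffOn_const.mul (contDiffOn_fderiv_apply hu _)))

lemma contDiffOn_dzbar {u : ℂ → ℂ} {m : ℕ} (hu : ContDiffOn ℝ (m + 1) u unitDisc) :
    ContDiffOn ℝ m (dzbar u) unitDisc := by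
  unfold dzbar
  exact contDiffOn_const.mul ((contDiffOn_fderiv_apply hu 1).add
    (contDiffOn_const.mul (contDiffOn_fderiv_apply hu _)))

lemma continuousOn_dz {u : ℂ → ℂ} (hu : ContDiffOn ℝ 1 u unitDisc) :
    ContinuousOn (dz u) unitDisc :=
  (contDiffOn_dz (m := 0) (by simpa using hu)).continuousOn

lemma continuousOn_dzbar {u : ℂ → ℂ} (hu : ContDiffOn ℝ 1 u unitDisc) :
    ContinuousOn (dzbar u) unitDisc :=
  (contDiffOn_dzbar (m := 0) (by simpa using hu)).continuousOn

lemma exists_bound_closedBall {u : ℂ → ℂ} (hu : ContinuousOn u unitDisc) {ρ : ℝ} (hρ : ρ < 1) :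
    ∃ C, ∀ z, ‖z‖ ≤ ρ → ‖u z‖ ≤ C := by
  obtain ⟨C, hC⟩ := (isCompact_closedBall (0 : ℂ) ρ).exists_bound_of_continuousOn
    (hu.mono (Metric.closedBall_subset_ball hρ))
  exact ⟨C, fun z hz => hC z (by simpa using hz)⟩

lemma fcoef_shift_eq (v : ℂ → ℂ) (n k : ℤ) (r : ℝ) :
    fcoef (n + k) v r = (2 * Real.pi : ℂ)⁻¹ * ∫ θ in (0 : ℝ)..(2 * Real.pi),
      Complex.exp (-(k * θ * Complex.I)) * v (r * Complex.exp (θ * Complex.I))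
        * Complex.exp (-(n * θ * Complex.I)) := by
  rw [fcoef]
  congr 2
  ext θ
  rw [show (-(((n + k : ℤ) : ℂ) * θ * Complex.I)) =
    -(k * θ * Complex.I) + -(n * θ * Complex.I) by push_cast; ring, Complex.exp_add]
  ring

/-- Differentiation under the integral: the radial derivative of `u` is `e^{iθ} ∂_z u + e^{-iθ} ∂_z̄
u`, and the exponentials shift the index. -/
lemma hasDerivAt_fcoef {u : ℂ → ℂ} (hu : ContDiffOn ℝ 1 u unitDisc) (n : ℤ) {r : ℝ}
    (hr : |r| < 1) :
    HasDerivAt (fcoef n u) (fcoef (n - 1) (dz u) r + fcoef (n + 1) (dzbar u) r) r := by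
  obtain ⟨ρ, hrρ, hρ⟩ := exists_between hr
  obtain ⟨C, hC⟩ := exists_bound_closedBall (continuousOn_dz hu) hρ
  obtain ⟨D, hD⟩ := exists_bound_closedBall (continuousOn_dzbar hu) hρ
  have hc1 : Continuous fun θ : ℝ => Complex.exp (θ * Complex.I)
      * dz u (r * Complex.exp (θ * Complex.I)) * Complex.exp (-(n * θ * Complex.I)) :=
    ((by fun_prop : Continuous fun θ : ℝ => Complex.exp (θ * Complex.I)).mul
      (continuous_comp_circle (continuousOn_dz hu) hr)).mul (by fun_prop)
  have hc2 : Continuous fun θ : ℝ => Complex.exp (-(θ * Complex.I))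
      * dzbar u (r * Complex.exp (θ * Complex.I)) * Complex.exp (-(n * θ * Complex.I)) :=
    ((by fun_prop : Continuous fun θ : ℝ => Complex.exp (-(θ * Complex.I))).mul
      (continuous_comp_circle (continuousOn_dzbar hu) hr)).mul (by fun_prop)
  have hmem : Metric.ball (0 : ℝ) ρ ∈ 𝓝 r := Metric.isOpen_ball.mem_nhds (by simpa using hrρ)
  have key := intervalIntegral.hasDerivAt_integral_of_dominated_loc_of_deriv_le
    (μ := MeasureTheory.volume) (a := 0) (b := 2 * Real.pi) (x₀ := r)
    (F := fun (s : ℝ) (θ : ℝ) =>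
      u (s * Complex.exp (θ * Complex.I)) * Complex.exp (-(n * θ * Complex.I)))
    (F' := fun (s : ℝ) (θ : ℝ) => Complex.exp (θ * Complex.I)
      * dz u (s * Complex.exp (θ * Complex.I)) * Complex.exp (-(n * θ * Complex.I))
      + Complex.exp (-(θ * Complex.I))
      * dzbar u (s * Complex.exp (θ * Complex.I)) * Complex.exp (-(n * θ * Complex.I)))
    (bound := fun _ => C + D) hmem ?_
    ((continuous_fcoef_integrand hu.continuousOn n hr).intervalIntegrable _ _)
    (hc1.add hc2).aestronglyMeasurable ?_ (by simp) ?_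
  · have h2 := key.2.const_mul (2 * Real.pi : ℂ)⁻¹
    refine h2.congr_deriv ?_
    rw [intervalIntegral.integral_add (hc1.intervalIntegrable _ _) (hc2.intervalIntegrable _ _),
      mul_add, sub_eq_add_neg n 1, fcoef_shift_eq, fcoef_shift_eq]
    simp
  · filter_upwards [hmem] with s hs
    refine (continuous_fcoef_integrand hu.continuousOn n ?_).aestronglyMeasurable
    exact (show |s| < ρ by simpa using hs).trans hρ
  · refine Eventually.of_forall fun θ _ s hs => ?_
    have hz : ‖(s : ℂ) * Complex.exp (θ * Complex.I)‖ ≤ ρ := by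
      rw [norm_ofReal_mul_exp]; exact (show |s| < ρ by simpa using hs).le
    refine (norm_add_le _ _).trans ?_
    simp only [norm_mul, norm_exp_neg_int_mul, mul_one, Complex.norm_exp_ofReal_mul_I, one_mul]
    rw [← conj_exp_ofReal_mul_I, Complex.norm_conj, Complex.norm_exp_ofReal_mul_I, one_mul]
    exact add_le_add (hC _ hz) (hD _ hz)
  · refine Eventually.of_forall fun θ _ s hs => ?_
    have hs1 : |s| < 1 := (show |s| < ρ by simpa using hs).trans hρ
    have hd : DifferentiableAt ℝ u (s * Complex.exp (θ * Complex.I)) :=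
      (hu.differentiableOn one_ne_zero).differentiableAt
        (isOpen_unitDisc.mem_nhds (ofReal_mul_exp_mem_unitDisc hs1 θ))
    have hl : HasDerivAt (fun t : ℝ => (t : ℂ) * Complex.exp (θ * Complex.I))
        (Complex.exp (θ * Complex.I)) s := by
      simpa using (Complex.ofRealCLM.hasDerivAt (x := s)).mul_const (Complex.exp (θ * Complex.I))
    have := (hd.hasFDerivAt.comp_hasDerivAt s hl).mul_const (Complex.exp (-(n * θ * Complex.I)))
    refine this.congr_deriv ?_
    rw [fderiv_eq_wirtinger, conj_exp_ofReal_mul_I]; ring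

lemma integral_lincomb {f g h : ℝ → ℂ} (hf : Continuous f) (hg : Continuous g)
    (hh : Continuous h) (a b : ℂ) (s t : ℝ) :
    ∫ θ in s..t, (a * f θ - a * g θ - b * h θ) =
      a * (∫ θ in s..t, f θ) - a * (∫ θ in s..t, g θ) - b * ∫ θ in s..t, h θ := by
  have hf' : Continuous fun θ => a * f θ := hf.const_mul a
  have hg' : Continuous fun θ => a * g θ := hg.const_mul a
  have hh' : Continuous fun θ => b * h θ := hh.const_mul b
  rw [intervalIntegral.integral_sub (f := fun θ => a * f θ - a * g θ)
      ((hf'.sub hg').intervalIntegrable _ _)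
      (hh'.intervalIntegrable _ _),
    intervalIntegral.integral_sub (hf'.intervalIntegrable _ _) (hg'.intervalIntegrable _ _),
    intervalIntegral.integral_const_mul, intervalIntegral.integral_const_mul,
    intervalIntegral.integral_const_mul]

/-- The `θ`-derivative of `u e^{-inθ}` has zero integral over a period, and `∂_θ u = i (z ∂_z u - z̄
∂_z̄ u)`. With `hasDerivAt_fcoef` this gives both the sum and the difference of the two derivative
coefficients. -/
lemma int_mul_fcoef {u : ℂ → ℂ} (hu : ContDiffOn ℝ 1 u unitDisc) (n : ℤ) {r : ℝ} (hr : |r| < 1) :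
    n * fcoef n u r = r * (fcoef (n - 1) (dz u) r - fcoef (n + 1) (dzbar u) r) := by
  have hc1 : Continuous fun θ : ℝ => Complex.exp (θ * Complex.I)
      * dz u (r * Complex.exp (θ * Complex.I)) * Complex.exp (-(n * θ * Complex.I)) :=
    ((by fun_prop : Continuous fun θ : ℝ => Complex.exp (θ * Complex.I)).mul
      (continuous_comp_circle (continuousOn_dz hu) hr)).mul (by fun_prop)
  have hc2 : Continuous fun θ : ℝ => Complex.exp (-(θ * Complex.I))
      * dzbar u (r * Complex.exp (θ * Complex.I)) * Complex.exp (-(n * θ * Complex.I)) :=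
    ((by fun_prop : Continuous fun θ : ℝ => Complex.exp (-(θ * Complex.I))).mul
      (continuous_comp_circle (continuousOn_dzbar hu) hr)).mul (by fun_prop)
  have hc0 := continuous_fcoef_integrand hu.continuousOn n hr
  have hder : ∀ θ : ℝ, HasDerivAt (fun θ : ℝ => u (r * Complex.exp (θ * Complex.I))
      * Complex.exp (-(n * θ * Complex.I)))
      (Complex.I * r * (Complex.exp (θ * Complex.I)
      * dz u (r * Complex.exp (θ * Complex.I)) * Complex.exp (-(n * θ * Complex.I)))
      - Complex.I * r * (Complex.exp (-(θ * Complex.I))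
      * dzbar u (r * Complex.exp (θ * Complex.I)) * Complex.exp (-(n * θ * Complex.I)))
      - Complex.I * n * (u (r * Complex.exp (θ * Complex.I))
      * Complex.exp (-(n * θ * Complex.I)))) θ := by
    intro θ
    have hd : DifferentiableAt ℝ u (r * Complex.exp (θ * Complex.I)) :=
      (hu.differentiableOn one_ne_zero).differentiableAt
        (isOpen_unitDisc.mem_nhds (ofReal_mul_exp_mem_unitDisc hr θ))
    have hi := Complex.ofRealCLM.hasDerivAt (x := θ)
    have hl : HasDerivAt (fun t : ℝ => (r : ℂ) * Complex.exp (t * Complex.I))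
        (r * (Complex.exp (θ * Complex.I) * Complex.I)) θ := by
      simpa using ((hi.mul_const Complex.I).cexp).const_mul (r : ℂ)
    have he : HasDerivAt (fun t : ℝ => Complex.exp (-(n * t * Complex.I)))
        (Complex.exp (-(n * θ * Complex.I)) * -(n * Complex.I)) θ := by
      simpa using (((hi.const_mul (n : ℂ)).mul_const Complex.I).neg).cexp
    refine ((hd.hasFDerivAt.comp_hasDerivAt θ hl).mul he).congr_deriv ?_
    rw [fderiv_eq_wirtinger, map_mul, map_mul, conj_exp_ofReal_mul_I, Complex.conj_ofReal,
      Complex.conj_I]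
    ring
  have hcd : Continuous fun θ : ℝ => (Complex.I * r * (Complex.exp (θ * Complex.I)
      * dz u (r * Complex.exp (θ * Complex.I)) * Complex.exp (-(n * θ * Complex.I)))
      - Complex.I * r * (Complex.exp (-(θ * Complex.I))
      * dzbar u (r * Complex.exp (θ * Complex.I)) * Complex.exp (-(n * θ * Complex.I)))
      - Complex.I * n * (u (r * Complex.exp (θ * Complex.I))
      * Complex.exp (-(n * θ * Complex.I)))) :=
    ((hc1.const_mul _).sub (hc2.const_mul _)).sub (hc0.const_mul _)
  have hint := intervalIntegral.integral_eq_sub_of_hasDerivAt (fun θ _ => hder θ)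
    (hcd.intervalIntegrable 0 (2 * Real.pi))
  rw [integral_lincomb hc1 hc2 hc0] at hint
  have e1 : Complex.exp (((2 * Real.pi : ℝ) : ℂ) * Complex.I) = 1 := by
    push_cast; exact Complex.exp_two_pi_mul_I
  have e2 : Complex.exp (-(n * ((2 * Real.pi : ℝ) : ℂ) * Complex.I)) = 1 := by
    push_cast
    rw [Complex.exp_neg, mul_assoc, Complex.exp_int_mul_two_pi_mul_I, inv_one]
  rw [e1, e2] at hint
  rw [sub_eq_add_neg n 1, fcoef_shift_eq, fcoef_shift_eq, fcoef]
  simp only [Complex.ofReal_zero, zero_mul, mul_zero, neg_zero, Complex.exp_zero, sub_self] at hint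
  simp only [Int.cast_neg, Int.cast_one, neg_mul, one_mul, neg_neg]
  generalize (∫ θ in (0 : ℝ)..(2 * Real.pi), Complex.exp (θ * Complex.I)
      * dz u (r * Complex.exp (θ * Complex.I)) * Complex.exp (-(n * θ * Complex.I))) = P at hint ⊢
  generalize (∫ θ in (0 : ℝ)..(2 * Real.pi), Complex.exp (-(θ * Complex.I))
      * dzbar u (r * Complex.exp (θ * Complex.I)) * Complex.exp (-(n * θ * Complex.I))) = Q
    at hint ⊢
  generalize (∫ θ in (0 : ℝ)..(2 * Real.pi), u (r * Complex.exp (θ * Complex.I))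
      * Complex.exp (-(n * θ * Complex.I))) = X at hint ⊢
  linear_combination (Complex.I * (2 * Real.pi : ℂ)⁻¹) * hint
    + ((2 * Real.pi : ℂ)⁻¹ * (n * X - r * P + r * Q)) * Complex.I_mul_I

/-! ### The radial system and its solutions regular at the origin. -/

/-- The first-order system on `(0, 1)` satisfied by the `n`-th Fourier coefficient `f` of an
`(a, b)`-harmonic function and the `(n + 1)`-th Fourier coefficient `q` of its
`∂_{z̄}`-derivative. -/
def RadialSystem (n a b : ℝ) (f q : ℝ → ℂ) : Prop :=
  ∀ r ∈ Set.Ioo (0 : ℝ) 1, HasDerivAt f (2 * q r + n * f r / r) r ∧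
    HasDerivAt q (-2 * ((a + b) * r * q r + a * (n - b) * f r) / (1 - r ^ 2)
      - (n + 1) * q r / r) r

lemma abs_lt_one_of_mem_Ioo {r : ℝ} (hr : r ∈ Set.Ioo (0 : ℝ) 1) : |r| < 1 := by
  rw [abs_of_pos hr.1]; exact hr.2

lemma one_sub_sq_pos {r : ℝ} (hr : r ∈ Set.Ioo (0 : ℝ) 1) : 0 < 1 - r ^ 2 := by
  nlinarith [hr.1, hr.2]

lemma ofReal_one_sub_sq_ne_zero {r : ℝ} (hr : r ∈ Set.Ioo (0 : ℝ) 1) : (1 - (r : ℂ) ^ 2) ≠ 0 := by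
  exact_mod_cast (one_sub_sq_pos hr).ne'

lemma IsABHarmonic.contDiffOn_dzbar {a b : ℝ} {u : ℂ → ℂ} (hu : IsABHarmonic a b u) :
    ContDiffOn ℝ 1 (dzbar u) unitDisc :=
  _root_.contDiffOn_dzbar (m := 1) (by exact_mod_cast hu.1)

lemma IsABHarmonic.contDiffOn_one {a b : ℝ} {u : ℂ → ℂ} (hu : IsABHarmonic a b u) :
    ContDiffOn ℝ 1 u unitDisc := hu.1.of_le (by norm_num)

lemma IsABHarmonic.fcoef_relation {a b : ℝ} {u : ℂ → ℂ} (hu : IsABHarmonic a b u) (n : ℤ) {r : ℝ}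
    (hr : |r| < 1) :
    (1 - (r : ℂ) ^ 2) * fcoef n (dz (dzbar u)) r + (a * (r * fcoef (n - 1) (dz u) r)
      + (b * (r * fcoef (n + 1) (dzbar u) r) + -(a * b) * fcoef n u r)) = 0 := by
  have c0 := hu.1.continuousOn
  have c1 := continuousOn_dz hu.contDiffOn_one
  have c2 := continuousOn_dzbar hu.contDiffOn_one
  have c3 := continuousOn_dz hu.contDiffOn_dzbar
  -- The outer factor `1 - |z|²` is cancelled. The right-hand side is written `0 * u z` so that
  -- `fcoef_const_mul` evaluates it.
  have e : ∀ z ∈ unitDisc, (1 - (‖z‖ : ℂ) ^ 2) * dz (dzbar u) z + (a * (z * dz u z)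
      + (b * ((starRingEnd ℂ) z * dzbar u z) + -(a * b) * u z)) = 0 * u z := by
    intro z hz
    have h := hu.2 z hz
    have hz1 : ‖z‖ < 1 := by simpa [unitDisc] using hz
    have hne : (1 - (‖z‖ : ℂ) ^ 2) ≠ 0 := by
      have : (1 - ‖z‖ ^ 2) ≠ 0 := by nlinarith [norm_nonneg z]
      exact_mod_cast this
    have := (mul_eq_zero.1 h).resolve_left hne
    linear_combination this
  have h := fcoef_congr e n hr
  have k4 : ContinuousOn (fun z => -(a * b : ℂ) * u z) unitDisc := by fun_prop
  have k3 : ContinuousOn (fun z => (b : ℂ) * ((starRingEnd ℂ) z * dzbar u z)) unitDisc :=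
    continuousOn_const.mul (Complex.continuous_conj.continuousOn.mul c2)
  have k2 : ContinuousOn (fun z => (a : ℂ) * (z * dz u z)) unitDisc := by fun_prop
  have k1 : ContinuousOn (fun z : ℂ => (1 - (‖z‖ : ℂ) ^ 2) * dz (dzbar u) z) unitDisc :=
    (by fun_prop : Continuous fun z : ℂ => (1 - (‖z‖ : ℂ) ^ 2)).continuousOn.mul c3
  have k34 : ContinuousOn (fun z => (b : ℂ) * ((starRingEnd ℂ) z * dzbar u z)
      + -(a * b : ℂ) * u z) unitDisc := k3.add k4
  have k234 : ContinuousOn (fun z => (a : ℂ) * (z * dz u z)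
      + (b * ((starRingEnd ℂ) z * dzbar u z) + -(a * b : ℂ) * u z)) unitDisc := k2.add k34
  rw [fcoef_add k1 k234 n hr, fcoef_add k2 k34 n hr,
    fcoef_add k3 k4 n hr, fcoef_const_mul, fcoef_const_mul, fcoef_const_mul, fcoef_const_mul,
    fcoef_id_mul, fcoef_conj_mul, fcoef_radial_mul (fun s => 1 - (s : ℂ) ^ 2)] at h
  have h2 : ((|r| : ℝ) : ℂ) ^ 2 = (r : ℂ) ^ 2 := by exact_mod_cast sq_abs r
  rw [h2] at h
  linear_combination h

lemma IsABHarmonic.radialSystem {a b : ℝ} {u : ℂ → ℂ} (hu : IsABHarmonic a b u) (n : ℤ) :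
    RadialSystem n a b (fcoef n u) (fcoef (n + 1) (dzbar u)) := by
  intro r hr
  have hr1 := abs_lt_one_of_mem_Ioo hr
  have hr0 : (r : ℂ) ≠ 0 := by exact_mod_cast hr.1.ne'
  have hr2 := ofReal_one_sub_sq_ne_zero hr
  have i1 := int_mul_fcoef hu.contDiffOn_one n hr1
  have i2 := int_mul_fcoef hu.contDiffOn_dzbar (n + 1) hr1
  have rel := hu.fcoef_relation n hr1
  rw [add_sub_cancel_right] at i2
  -- `i1` eliminates the coefficient of `∂_z u`. Below, `i2` replaces that of `∂_z̄ ∂_z̄ u` by that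
  -- of `∂_z ∂_z̄ u`, which the differential equation determines.
  have p : fcoef (n - 1) (dz u) r = fcoef (n + 1) (dzbar u) r + n * fcoef n u r / r := by
    field_simp; linear_combination -i1
  refine ⟨(hasDerivAt_fcoef hu.contDiffOn_one n hr1).congr_deriv ?_,
    (hasDerivAt_fcoef hu.contDiffOn_dzbar (n + 1) hr1).congr_deriv ?_⟩
  · rw [p]; push_cast; ring
  · rw [add_sub_cancel_right]
    have t : fcoef (n + 1 + 1) (dzbar (dzbar u)) r = fcoef n (dz (dzbar u)) r
        - (n + 1) * fcoef (n + 1) (dzbar u) r / r := by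
      push_cast at i2
      field_simp; linear_combination i2
    rw [p] at rel
    have s : fcoef n (dz (dzbar u)) r = -((a + b) * r * fcoef (n + 1) (dzbar u) r
        + a * (n - b) * fcoef n u r) / (1 - (r : ℂ) ^ 2) := by
      rw [eq_div_iff hr2]
      field_simp at rel
      linear_combination rel
    rw [t, s]; push_cast; ring

lemma continuousAt_fcoef_zero {u : ℂ → ℂ} (hu : ContDiffOn ℝ 1 u unitDisc) (n : ℤ) :
    ContinuousAt (fcoef n u) 0 := (hasDerivAt_fcoef hu n (by simp)).continuousAt

lemma eq_of_hasDerivAt_zero {g : ℝ → ℂ} {s t : ℝ} (h : ∀ r ∈ Set.Ioo s t, HasDerivAt g 0 r)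
    {x y : ℝ} (hx : x ∈ Set.Ioo s t) (hy : y ∈ Set.Ioo s t) : g x = g y :=
  isOpen_Ioo.is_const_of_deriv_eq_zero isPreconnected_Ioo
    (fun r hr => (h r hr).differentiableAt.differentiableWithinAt) (fun r hr => (h r hr).deriv) hx hy

/-- Liouville's formula: the trace of the system is `-1/r - 2(a+b)r/(1-r²)`, so `r (1-r²)^{-(a+b)}`
times the Wronskian is constant. Both pairs are continuous at 0, hence the factor `r` forces the
constant to be 0. -/
lemma RadialSystem.wronskian_eq_zero {n a b : ℝ} {f q y w : ℝ → ℂ} (hf : RadialSystem n a b f q)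
    (hy : RadialSystem n a b y w) (f0 : ContinuousAt f 0) (q0 : ContinuousAt q 0)
    (y0 : ContinuousAt y 0) (w0 : ContinuousAt w 0) {r : ℝ} (hr : r ∈ Set.Ioo (0 : ℝ) 1) :
    f r * w r = q r * y r := by
  set G : ℝ → ℂ := fun r => (((1 - r ^ 2) ^ (-(a + b)) : ℝ) : ℂ) * (r * (f r * w r - q r * y r))
    with hG
  have hder : ∀ r ∈ Set.Ioo (0 : ℝ) 1, HasDerivAt G 0 r := by
    intro r hr
    have hp := one_sub_sq_pos hr
    have hr0 : (r : ℂ) ≠ 0 := by exact_mod_cast hr.1.ne'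
    have hr2 := ofReal_one_sub_sq_ne_zero hr
    have h1 : HasDerivAt (fun r : ℝ => (1 - r ^ 2) ^ (-(a + b)))
        ((1 - r ^ 2) ^ (-(a + b)) * (2 * (a + b) * r / (1 - r ^ 2))) r := by
      have := (((hasDerivAt_pow 2 r).const_sub 1).rpow_const (p := -(a + b)) (Or.inl hp.ne'))
      refine this.congr_deriv ?_
      rw [Real.rpow_sub_one hp.ne']; field_simp; simp; ring
    obtain ⟨f1, q1⟩ := hf r hr
    obtain ⟨y1, w1⟩ := hy r hr
    have h2 := h1.ofReal_comp.mul
      ((Complex.ofRealCLM.hasDerivAt (x := r)).mul ((f1.mul w1).sub (q1.mul y1)))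
    refine h2.congr_deriv ?_
    simp only [Complex.ofRealCLM_apply, Pi.mul_apply, Pi.sub_apply]
    push_cast
    field_simp
    ring
  have hlim : Tendsto G (𝓝[>] 0) (𝓝 0) := by
    have hc : ContinuousAt G 0 := by
      have h1 : ContinuousAt (fun r : ℝ => (1 - r ^ 2) ^ (-(a + b))) 0 :=
        ContinuousAt.rpow_const (by fun_prop) (Or.inl (by norm_num))
      have h2 : ContinuousAt (fun r : ℝ => (((1 - r ^ 2) ^ (-(a + b)) : ℝ) : ℂ)) 0 :=
        Complex.continuous_ofReal.continuousAt.comp h1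
      exact h2.mul (Complex.continuous_ofReal.continuousAt.mul ((f0.mul w0).sub (q0.mul y0)))
    have := hc.tendsto.mono_left (nhdsWithin_le_nhds (s := Set.Ioi (0 : ℝ)))
    simpa [hG] using this
  have hconst : Tendsto G (𝓝[>] 0) (𝓝 (G r)) := by
    refine tendsto_const_nhds.congr' ?_
    filter_upwards [Ioo_mem_nhdsGT (show (0 : ℝ) < 1 by norm_num)] with x hx
    exact eq_of_hasDerivAt_zero hder hr hx
  have hz : G r = 0 := tendsto_nhds_unique hconst hlim
  have h1 : (((1 - r ^ 2) ^ (-(a + b)) : ℝ) : ℂ) ≠ 0 := by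
    exact_mod_cast (Real.rpow_pos_of_pos (one_sub_sq_pos hr) _).ne'
  have hr0 : (r : ℂ) ≠ 0 := by exact_mod_cast hr.1.ne'
  have := (mul_eq_zero.1 ((mul_eq_zero.1 hz).resolve_left h1)).resolve_left hr0
  exact sub_eq_zero.1 this

/-- The matrix of the radial system. -/
noncomputable def radialField (n a b t : ℝ) : ℂ × ℂ →L[ℂ] ℂ × ℂ :=
  (2 : ℂ) • (ContinuousLinearMap.snd ℂ ℂ ℂ).prod 0
    + ((n / t : ℝ) : ℂ) • (ContinuousLinearMap.fst ℂ ℂ ℂ).prod 0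
    + ((-2 * (a + b) * t / (1 - t ^ 2) - (n + 1) / t : ℝ) : ℂ) •
      (0 : ℂ × ℂ →L[ℂ] ℂ).prod (ContinuousLinearMap.snd ℂ ℂ ℂ)
    + ((-2 * a * (n - b) / (1 - t ^ 2) : ℝ) : ℂ) •
      (0 : ℂ × ℂ →L[ℂ] ℂ).prod (ContinuousLinearMap.fst ℂ ℂ ℂ)

lemma radialField_apply (n a b t : ℝ) (x : ℂ × ℂ) : radialField n a b t x =
    (2 * x.2 + n * x.1 / t, -2 * ((a + b) * t * x.2 + a * (n - b) * x.1) / (1 - t ^ 2)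
      - (n + 1) * x.2 / t) := by
  simp only [radialField]
  ext <;> simp <;> ring

lemma continuousOn_radialField (n a b : ℝ) :
    ContinuousOn (radialField n a b) (Set.Ioo (0 : ℝ) 1) := by
  have h1 : ∀ t ∈ Set.Ioo (0 : ℝ) 1, t ≠ 0 := fun t ht => ht.1.ne'
  have h2 : ∀ t ∈ Set.Ioo (0 : ℝ) 1, 1 - t ^ 2 ≠ 0 := fun t ht => (one_sub_sq_pos ht).ne'
  have c1 : ContinuousOn (fun t : ℝ => n / t) (Set.Ioo (0 : ℝ) 1) := by fun_prop (disch := assumption)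
  have c2 : ContinuousOn (fun t : ℝ => -2 * (a + b) * t / (1 - t ^ 2) - (n + 1) / t)
    (Set.Ioo (0 : ℝ) 1) := by fun_prop (disch := assumption)
  have c3 : ContinuousOn (fun t : ℝ => -2 * a * (n - b) / (1 - t ^ 2)) (Set.Ioo (0 : ℝ) 1) := by
    fun_prop (disch := assumption)
  unfold radialField
  exact ((continuousOn_const.add
    ((Complex.continuous_ofReal.comp_continuousOn c1).smul continuousOn_const)).add
    ((Complex.continuous_ofReal.comp_continuousOn c2).smul continuousOn_const)).add
    ((Complex.continuous_ofReal.comp_continuousOn c3).smul continuousOn_const)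

lemma RadialSystem.hasDerivAt_prod {n a b : ℝ} {f q : ℝ → ℂ} (hf : RadialSystem n a b f q) {r : ℝ}
    (hr : r ∈ Set.Ioo (0 : ℝ) 1) :
    HasDerivAt (fun t => (f t, q t)) (radialField n a b r (f r, q r)) r := by
  rw [radialField_apply]
  exact (hf r hr).1.prodMk (hf r hr).2

lemma RadialSystem.const_mul {n a b : ℝ} {f q : ℝ → ℂ} (hf : RadialSystem n a b f q) (c : ℂ) :
    RadialSystem n a b (fun r => c * f r) (fun r => c * q r) := fun r hr =>
  ⟨((hf r hr).1.const_mul c).congr_deriv (by ring),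
    ((hf r hr).2.const_mul c).congr_deriv (by ring)⟩

/-- Uniqueness on a compact subinterval of `(0, 1)` containing `t` and `r`, where the system has
bounded coefficients. It carries proportionality past possible zeros of the reference solution. -/
lemma RadialSystem.eq_of_eq_at {n a b : ℝ} {f q y w : ℝ → ℂ} (hf : RadialSystem n a b f q)
    (hy : RadialSystem n a b y w) {t : ℝ} (ht : t ∈ Set.Ioo (0 : ℝ) 1) (h1 : f t = y t)
    (h2 : q t = w t) {r : ℝ} (hr : r ∈ Set.Ioo (0 : ℝ) 1) : f r = y r := by
  obtain ⟨s₀, hs₀, hs₁⟩ := exists_between (lt_min ht.1 hr.1)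
  obtain ⟨s₂, hs₂, hs₃⟩ := exists_between (max_lt ht.2 hr.2)
  have hsub : Set.Icc s₀ s₂ ⊆ Set.Ioo (0 : ℝ) 1 :=
    fun x hx => ⟨hs₀.trans_le hx.1, hx.2.trans_lt hs₃⟩
  obtain ⟨C, hC⟩ := isCompact_Icc.exists_bound_of_continuousOn
    ((continuousOn_radialField n a b).mono hsub)
  have hsub' : Set.Ioo s₀ s₂ ⊆ Set.Ioo (0 : ℝ) 1 := Set.Ioo_subset_Icc_self.trans hsub
  have key := ODE_solution_unique_of_mem_Ioo (v := fun t x => radialField n a b t x)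
    (s := fun _ => Set.univ) (K := C.toNNReal) (a := s₀) (b := s₂) (t₀ := t)
    (f := fun t => (f t, q t)) (g := fun t => (y t, w t))
    (fun x hx => ((radialField n a b x).lipschitz.weaken (by
      rw [← NNReal.coe_le_coe, coe_nnnorm]
      exact (hC x (Set.Ioo_subset_Icc_self hx)).trans (Real.le_coe_toNNReal C))).lipschitzOnWith)
    ⟨hs₁.trans_le (min_le_left _ _), (le_max_left _ _).trans_lt hs₂⟩
    (fun x hx => ⟨hf.hasDerivAt_prod (hsub' hx), trivial⟩)
    (fun x hx => ⟨hy.hasDerivAt_prod (hsub' hx), trivial⟩) (by simp [h1, h2])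
  exact congrArg Prod.fst
    (key ⟨hs₁.trans_le (min_le_right _ _), (le_max_right _ _).trans_lt hs₂⟩)

/-- Solutions of the radial system that are regular at the origin are proportional. -/
lemma RadialSystem.exists_eq_const_mul {n a b : ℝ} {f q y w : ℝ → ℂ} (hf : RadialSystem n a b f q)
    (hy : RadialSystem n a b y w) (f0 : ContinuousAt f 0) (q0 : ContinuousAt q 0)
    (y0 : ContinuousAt y 0) (w0 : ContinuousAt w 0) (hne : ∀ᶠ r in 𝓝[>] (0 : ℝ), y r ≠ 0) :
    ∃ c : ℂ, ∀ r ∈ Set.Ioo (0 : ℝ) 1, f r = c * y r := by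
  have hW := fun r hr => hf.wronskian_eq_zero hy f0 q0 y0 w0 (r := r) hr
  have hne' := hne.and (Ioo_mem_nhdsGT (show (0 : ℝ) < 1 by norm_num))
  obtain ⟨ε, hε, hsub⟩ := (mem_nhdsGT_iff_exists_Ioo_subset).1 hne'
  have hε : 0 < ε := hε
  -- The numerator of `(f / y)'` is `2 (q y - f w)`, a multiple of the Wronskian.
  have hconst : ∀ r ∈ Set.Ioo 0 ε, HasDerivAt (fun t => f t / y t) 0 r := by
    intro r hr
    obtain ⟨hyr, hr1⟩ := hsub hr
    refine ((hf r hr1).1.div (hy r hr1).1 hyr).congr_deriv ?_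
    rw [div_eq_zero_iff]; left
    linear_combination (-2) * hW r hr1
  have ht : ε / 2 ∈ Set.Ioo 0 ε := ⟨by positivity, by linarith⟩
  set c := f (ε / 2) / y (ε / 2) with hc
  have hcy : ∀ r ∈ Set.Ioo 0 ε, f r = c * y r := fun r hr => by
    have := eq_of_hasDerivAt_zero hconst hr ht
    rw [← div_eq_iff (hsub hr).1]; exact this
  refine ⟨c, fun r hr => hf.eq_of_eq_at (hy.const_mul c) (hsub ht).2 (hcy _ ht) ?_ hr⟩
  have h1 := hW _ (hsub ht).2
  rw [hcy _ ht] at h1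
  refine mul_right_cancel₀ (hsub ht).1 ?_
  rw [← h1]; ring

/-! ### Hypergeometric solutions of the radial system. -/

lemma ConvergesOnUnit.hasDerivAt_comp_sq {A : ℕ → ℝ} (hA : ConvergesOnUnit A) {r : ℝ}
    (hr : |r| < 1) :
    HasDerivAt (fun t => powerSum A (t ^ 2)) (2 * r * powerSum (_root_.derivCoeff A) (r ^ 2)) r := by
  have hr2 : |r ^ 2| < 1 := by rw [abs_pow]; exact pow_lt_one₀ (abs_nonneg r) hr two_ne_zero
  have h2 : HasDerivAt (fun t : ℝ => t ^ 2) (2 * r) r := by simpa using hasDerivAt_pow 2 r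
  refine (HasDerivAt.comp r (h₂ := powerSum A) (h := fun t : ℝ => t ^ 2)
    (hA.hasDerivAt hr2) h2).congr_deriv ?_
  ring

/-- The derivative is kept as `k * r ^ k / r` to match the term `n * f r / r` of `RadialSystem` and
to cover `k = 0`. -/
lemma hasDerivAt_pow_div (k : ℕ) {r : ℝ} (hr : r ≠ 0) :
    HasDerivAt (fun t : ℝ => t ^ k) (k * r ^ k / r) r := by
  refine (hasDerivAt_pow k r).congr_deriv ?_
  rcases k with _ | k
  · simp
  · rw [Nat.add_sub_cancel]; field_simp; ring

lemma radialSystem_ofReal {n a b : ℝ} {y w : ℝ → ℝ}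
    (h : ∀ r ∈ Set.Ioo (0 : ℝ) 1, HasDerivAt y (2 * w r + n * y r / r) r ∧
      HasDerivAt w (-2 * ((a + b) * r * w r + a * (n - b) * y r) / (1 - r ^ 2)
        - (n + 1) * w r / r) r) :
    RadialSystem n a b (fun r => y r) (fun r => w r) := fun r hr =>
  ⟨(h r hr).1.ofReal_comp.congr_deriv (by push_cast; ring),
    (h r hr).2.ofReal_comp.congr_deriv (by push_cast; ring)⟩

/-- The first equation dictates the second component; the second equation is then the hypergeometric
equation at `r²`. -/
lemma radialSystem_nonneg_index (a b : ℝ) (k : ℕ) :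
    let A := ordinaryHypergeometricCoefficient (-a) (k - b) (k + 1)
    RadialSystem k a b (fun r => (powerSum A (r ^ 2) * r ^ k : ℝ))
      (fun r => (r ^ (k + 1) * powerSum (derivCoeff A) (r ^ 2) : ℝ)) := by
  intro A
  have hk : (0 : ℝ) < k + 1 := by positivity
  have hA : ConvergesOnUnit A := convergesOnUnit_ordinaryHypergeometric _ _ hk
  refine radialSystem_ofReal fun r hr => ?_
  have hr0 := hr.1.ne'
  have hr1 := abs_lt_one_of_mem_Ioo hr
  have hp := (one_sub_sq_pos hr).ne'
  have hr2 : |r ^ 2| < 1 := by rw [abs_pow]; exact pow_lt_one₀ (abs_nonneg r) hr1 two_ne_zero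
  have ode := hypergeometric_ode (-a) (k - b) hk hr2
  constructor
  · refine ((hA.hasDerivAt_comp_sq hr1).mul (hasDerivAt_pow_div k hr0)).congr_deriv ?_
    ring
  · refine ((hasDerivAt_pow_div (k + 1) hr0).mul (hA.derivCoeff.hasDerivAt_comp_sq hr1)).congr_deriv
      ?_
    field_simp
    push_cast
    linear_combination (2 * r ^ (k + 1)) * ode

/-- Here `∂_z̄` also falls on `z̄ ^ (m + 1)`, which produces the extra term `(m + 1) r^m F(r²)` in
the second component. -/
lemma radialSystem_neg_index (a b : ℝ) (m : ℕ) :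
    let A := ordinaryHypergeometricCoefficient (-b) (((m + 1 : ℕ) : ℝ) - a) (((m + 1 : ℕ) : ℝ) + 1)
    RadialSystem (-((m + 1 : ℕ) : ℝ)) a b (fun r => (powerSum A (r ^ 2) * r ^ (m + 1) : ℝ))
      (fun r => (r ^ (m + 2) * powerSum (derivCoeff A) (r ^ 2)
        + (m + 1) * r ^ m * powerSum A (r ^ 2) : ℝ)) := by
  intro A
  have hk : (0 : ℝ) < ((m + 1 : ℕ) : ℝ) + 1 := by positivity
  have hA : ConvergesOnUnit A := convergesOnUnit_ordinaryHypergeometric _ _ hk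
  refine radialSystem_ofReal fun r hr => ?_
  have hr0 := hr.1.ne'
  have hr1 := abs_lt_one_of_mem_Ioo hr
  have hp := (one_sub_sq_pos hr).ne'
  have hr2 : |r ^ 2| < 1 := by rw [abs_pow]; exact pow_lt_one₀ (abs_nonneg r) hr1 two_ne_zero
  have ode := hypergeometric_ode (-b) (((m + 1 : ℕ) : ℝ) - a) hk hr2
  change r ^ 2 * (1 - r ^ 2) * powerSum (derivCoeff (derivCoeff A)) (r ^ 2) + (_ - _ * r ^ 2)
    * powerSum (derivCoeff A) (r ^ 2) - _ * powerSum A (r ^ 2) = 0 at ode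
  push_cast at ode
  constructor
  · refine ((hA.hasDerivAt_comp_sq hr1).mul (hasDerivAt_pow_div (m + 1) hr0)).congr_deriv ?_
    push_cast
    field_simp
    ring
  · refine (((hasDerivAt_pow_div (m + 2) hr0).mul (hA.derivCoeff.hasDerivAt_comp_sq hr1)).add
      (((hasDerivAt_pow_div m hr0).const_mul (m + 1 : ℝ)).mul
        (hA.hasDerivAt_comp_sq hr1))).congr_deriv ?_
    push_cast
    field_simp
    linear_combination (2 * r ^ (m + 2)) * ode

/-- The radial factor of the `n`-th term of the homogeneous expansion. -/
noncomputable def radialSol (a b : ℝ) : ℤ → ℝ → ℝ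
  | Int.ofNat k, r =>
    powerSum (ordinaryHypergeometricCoefficient (-a) (k - b) (k + 1)) (r ^ 2) * r ^ k
  | Int.negSucc m, r =>
    powerSum (ordinaryHypergeometricCoefficient (-b) (((m + 1 : ℕ) : ℝ) - a)
      (((m + 1 : ℕ) : ℝ) + 1)) (r ^ 2) * r ^ (m + 1)

/-- The companion of `radialSol` in the radial system. -/
noncomputable def radialSolBar (a b : ℝ) : ℤ → ℝ → ℝ
  | Int.ofNat k, r => r ^ (k + 1) *
    powerSum (derivCoeff (ordinaryHypergeometricCoefficient (-a) (k - b) (k + 1))) (r ^ 2)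
  | Int.negSucc m, r => r ^ (m + 2) *
    powerSum (derivCoeff (ordinaryHypergeometricCoefficient (-b) (((m + 1 : ℕ) : ℝ) - a)
      (((m + 1 : ℕ) : ℝ) + 1))) (r ^ 2) + (m + 1) * r ^ m *
    powerSum (ordinaryHypergeometricCoefficient (-b) (((m + 1 : ℕ) : ℝ) - a)
      (((m + 1 : ℕ) : ℝ) + 1)) (r ^ 2)

lemma radialSystem_radialSol (a b : ℝ) (n : ℤ) :
    RadialSystem n a b (fun r => radialSol a b n r) (fun r => radialSolBar a b n r) := by
  rcases n with k | m
  · exact radialSystem_nonneg_index a b k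
  · have := radialSystem_neg_index a b m
    rw [show (((Int.negSucc m : ℤ)) : ℝ) = -((m + 1 : ℕ) : ℝ) by simp [Int.cast_negSucc]]
    exact this

lemma continuousAt_radialSol_zero (a b : ℝ) (n : ℤ) : ContinuousAt (radialSol a b n) 0 := by
  rcases n with k | m
  · have hA := convergesOnUnit_ordinaryHypergeometric (-a) (k - b)
      (by positivity : (0 : ℝ) < k + 1)
    exact (hA.hasDerivAt_comp_sq (r := 0) (by simp)).continuousAt.mul
      (continuous_pow k).continuousAt
  · have hA := convergesOnUnit_ordinaryHypergeometric (-b) (((m + 1 : ℕ) : ℝ) - a)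
      (by positivity : (0 : ℝ) < ((m + 1 : ℕ) : ℝ) + 1)
    exact (hA.hasDerivAt_comp_sq (r := 0) (by simp)).continuousAt.mul
      (continuous_pow (m + 1)).continuousAt

lemma continuousAt_radialSolBar_zero (a b : ℝ) (n : ℤ) : ContinuousAt (radialSolBar a b n) 0 := by
  rcases n with k | m
  · have hA := convergesOnUnit_ordinaryHypergeometric (-a) (k - b)
      (by positivity : (0 : ℝ) < k + 1)
    exact (continuous_pow (k + 1)).continuousAt.mul
      (hA.derivCoeff.hasDerivAt_comp_sq (r := 0) (by simp)).continuousAt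
  · have hA := convergesOnUnit_ordinaryHypergeometric (-b) (((m + 1 : ℕ) : ℝ) - a)
      (by positivity : (0 : ℝ) < ((m + 1 : ℕ) : ℝ) + 1)
    exact ((continuous_pow (m + 2)).continuousAt.mul
      (hA.derivCoeff.hasDerivAt_comp_sq (r := 0) (by simp)).continuousAt).add
      ((continuous_const.mul (continuous_pow m)).continuousAt.mul
      (hA.hasDerivAt_comp_sq (r := 0) (by simp)).continuousAt)

lemma eventually_powerSum_sq_ne_zero {A : ℕ → ℝ} (hA : ConvergesOnUnit A) (h0 : A 0 = 1) (k : ℕ) :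
    ∀ᶠ r in 𝓝[>] (0 : ℝ), powerSum A (r ^ 2) * r ^ k ≠ 0 := by
  have h1 : ∀ᶠ r in 𝓝 (0 : ℝ), powerSum A (r ^ 2) ≠ 0 :=
    (hA.hasDerivAt_comp_sq (r := 0) (by simp)).continuousAt.eventually_ne
      (by simp [powerSum_zero, h0])
  filter_upwards [nhdsWithin_le_nhds h1, self_mem_nhdsWithin] with r hr hr0
  exact mul_ne_zero hr (pow_ne_zero _ (ne_of_gt hr0))

lemma eventually_radialSol_ne_zero (a b : ℝ) (n : ℤ) :
    ∀ᶠ r in 𝓝[>] (0 : ℝ), radialSol a b n r ≠ 0 := by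
  rcases n with k | m
  · exact eventually_powerSum_sq_ne_zero (convergesOnUnit_ordinaryHypergeometric (-a) (k - b)
      (by positivity : (0 : ℝ) < k + 1)) (ordinaryHypergeometricCoefficient_zero _ _ _) _
  · exact eventually_powerSum_sq_ne_zero (convergesOnUnit_ordinaryHypergeometric (-b)
      (((m + 1 : ℕ) : ℝ) - a) (by positivity : (0 : ℝ) < ((m + 1 : ℕ) : ℝ) + 1))
      (ordinaryHypergeometricCoefficient_zero _ _ _) _

lemma IsABHarmonic.exists_fcoef_eq {a b : ℝ} {u : ℂ → ℂ} (hu : IsABHarmonic a b u) (n : ℤ) :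
    ∃ c : ℂ, ∀ r ∈ Set.Ico (0 : ℝ) 1, fcoef n u r = c * radialSol a b n r := by
  have hf0 := continuousAt_fcoef_zero hu.contDiffOn_one n
  have hs0 : ContinuousAt (fun r => (radialSol a b n r : ℂ)) 0 :=
    Complex.continuous_ofReal.continuousAt.comp (continuousAt_radialSol_zero a b n)
  obtain ⟨c, hc⟩ := (hu.radialSystem n).exists_eq_const_mul (radialSystem_radialSol a b n) hf0
    (continuousAt_fcoef_zero hu.contDiffOn_dzbar (n + 1)) hs0
    (Complex.continuous_ofReal.continuousAt.comp (continuousAt_radialSolBar_zero a b n))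
    ((eventually_radialSol_ne_zero a b n).mono fun r hr => by exact_mod_cast hr)
  refine ⟨c, fun r hr => ?_⟩
  -- The system lives on `(0, 1)`; the value at the centre follows by continuity.
  rcases hr.1.eq_or_lt with rfl | h0
  · have t1 : Tendsto (fcoef n u) (𝓝[>] 0) (𝓝 (fcoef n u 0)) :=
      hf0.tendsto.mono_left nhdsWithin_le_nhds
    have t2 : Tendsto (fun r => c * (radialSol a b n r : ℂ)) (𝓝[>] 0)
        (𝓝 (c * radialSol a b n 0)) :=
      (tendsto_const_nhds.mul hs0.tendsto).mono_left nhdsWithin_le_nhds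
    refine tendsto_nhds_unique t1 (t2.congr' ?_)
    filter_upwards [Ioo_mem_nhdsGT (show (0 : ℝ) < 1 by norm_num)] with x hx
    exact (hc x hx).symm
  · exact hc r ⟨h0, hr.2⟩

/-! ### Existence of the expansion and determination of its coefficients. -/

lemma posTerm_eq (a b : ℝ) (c : ℤ → ℂ) (k : ℕ) (r θ : ℝ) :
    posTerm a b c k (r * Complex.exp (θ * Complex.I)) =
      c k * radialSol a b k r * Complex.exp ((k : ℤ) * θ * Complex.I) := by
  rw [posTerm, norm_ofReal_mul_exp, sq_abs, ordinaryHypergeometric_eq_powerSum, mul_pow,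
    ← Complex.exp_nat_mul]
  change _ = c k * ((powerSum (ordinaryHypergeometricCoefficient (-a) (k - b) (k + 1)) (r ^ 2)
    * r ^ k : ℝ) : ℂ) * _
  push_cast
  rw [mul_assoc (k : ℂ)]; ring

lemma negTerm_eq (a b : ℝ) (c : ℤ → ℂ) (m : ℕ) (r θ : ℝ) :
    negTerm a b c (m + 1) (r * Complex.exp (θ * Complex.I)) =
      c (Int.negSucc m) * radialSol a b (Int.negSucc m) r
        * Complex.exp ((Int.negSucc m : ℤ) * θ * Complex.I) := by
  rw [negTerm, norm_ofReal_mul_exp, sq_abs, ordinaryHypergeometric_eq_powerSum, map_mul,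
    conj_exp_ofReal_mul_I, Complex.conj_ofReal, mul_pow, ← Complex.exp_nat_mul]
  change c (Int.negSucc m) * _ * _ = c (Int.negSucc m) *
    ((powerSum (ordinaryHypergeometricCoefficient (-b) (((m + 1 : ℕ) : ℝ) - a)
      (((m + 1 : ℕ) : ℝ) + 1)) (r ^ 2) * r ^ (m + 1) : ℝ) : ℂ) * _
  have e : ((Int.negSucc m : ℤ) : ℂ) * θ * Complex.I = ((m + 1 : ℕ) : ℂ) * -(θ * Complex.I) := by
    rw [Int.cast_negSucc]; ring
  rw [e, Complex.ofReal_mul, Complex.ofReal_pow]; ring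

lemma HasExpansion.hasSum {a b : ℝ} {u : ℂ → ℂ} {c : ℤ → ℂ} (h : HasExpansion a b u c) {r : ℝ}
    (hr : |r| < 1) (θ : ℝ) :
    HasSum (fun n : ℤ => c n * radialSol a b n r * Complex.exp (n * θ * Complex.I))
      (u (r * Complex.exp (θ * Complex.I))) := by
  obtain ⟨h1, h2, h3⟩ := h _ (ofReal_mul_exp_mem_unitDisc hr θ)
  rw [h3]
  refine HasSum.of_nat_of_neg_add_one (h1.hasSum.congr_fun fun k => (posTerm_eq a b c k r θ).symm)
    (h2.hasSum.congr_fun fun m => ?_)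
  rw [negTerm_eq, Int.negSucc_eq]

/-- Termwise integration is dominated by `‖d n‖`, which is summable by the convergence at `θ = 0`.
-/
lemma fcoef_eq_of_hasSum {u : ℂ → ℂ} {r : ℝ} {d : ℤ → ℂ}
    (h : ∀ θ : ℝ, HasSum (fun n : ℤ => d n * Complex.exp (n * θ * Complex.I))
      (u (r * Complex.exp (θ * Complex.I)))) (m : ℤ) : fcoef m u r = d m := by
  have hd : Summable fun n => ‖d n‖ := by
    have := (h 0).summable.norm
    simpa using this
  have key := intervalIntegral.hasSum_integral_of_dominated_convergence
    (μ := MeasureTheory.volume) (a := 0) (b := 2 * Real.pi)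
    (F := fun (n : ℤ) (θ : ℝ) => d n * Complex.exp (n * θ * Complex.I)
      * Complex.exp (-(m * θ * Complex.I)))
    (f := fun θ : ℝ => u (r * Complex.exp (θ * Complex.I)) * Complex.exp (-(m * θ * Complex.I)))
    (fun n _ => ‖d n‖)
    (fun n => (by fun_prop : Continuous fun θ : ℝ => d n * Complex.exp (n * θ * Complex.I)
      * Complex.exp (-(m * θ * Complex.I))).aestronglyMeasurable)
    (fun n => Eventually.of_forall fun θ _ => by
      rw [norm_mul, norm_mul, norm_exp_neg_int_mul,
        show (n : ℂ) * θ * Complex.I = ((n * θ : ℝ) : ℂ) * Complex.I by push_cast; ring,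
        Complex.norm_exp_ofReal_mul_I, mul_one, mul_one])
    (Eventually.of_forall fun θ _ => hd) (by simp)
    (Eventually.of_forall fun θ _ => (h θ).mul_right _)
  have hint : ∀ n : ℤ, (∫ θ in (0 : ℝ)..(2 * Real.pi), d n * Complex.exp (n * θ * Complex.I)
      * Complex.exp (-(m * θ * Complex.I))) = if n = m then (2 * Real.pi : ℂ) * d m else 0 := by
    intro n
    have e : ∀ θ : ℝ, d n * Complex.exp (n * θ * Complex.I) * Complex.exp (-(m * θ * Complex.I))
        = d n * Complex.exp ((((n - m : ℤ) : ℂ) * Complex.I) * θ) := fun θ => by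
      rw [mul_assoc, ← Complex.exp_add]; push_cast; ring_nf
    simp_rw [e]
    rw [intervalIntegral.integral_const_mul]
    split_ifs with hnm
    · subst hnm; simp; ring
    · have hne : ((n - m : ℤ) : ℂ) * Complex.I ≠ 0 :=
        mul_ne_zero (by exact_mod_cast sub_ne_zero.2 hnm) Complex.I_ne_zero
      rw [integral_exp_mul_complex hne]
      have : ((n - m : ℤ) : ℂ) * Complex.I * ((2 * Real.pi : ℝ) : ℂ)
          = ((n - m : ℤ) : ℂ) * (2 * Real.pi * Complex.I) := by push_cast; ring
      rw [this, Complex.exp_int_mul_two_pi_mul_I]; simp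
  simp_rw [hint] at key
  have h2 := key.unique (hasSum_ite_eq m ((2 * Real.pi : ℂ) * d m))
  rw [fcoef, h2]
  have : (Real.pi : ℂ) ≠ 0 := by exact_mod_cast Real.pi_ne_zero
  field_simp

lemma HasExpansion.fcoef_eq {a b : ℝ} {u : ℂ → ℂ} {c : ℤ → ℂ} (h : HasExpansion a b u c) {r : ℝ}
    (hr : |r| < 1) (n : ℤ) : fcoef n u r = c n * radialSol a b n r :=
  fcoef_eq_of_hasSum (d := fun n => c n * radialSol a b n r) (fun θ => h.hasSum hr θ) n

/-- The operator `z ∂_z - z̄ ∂_z̄` is `-i ∂_θ`. -/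
lemma fcoef_angular {u : ℂ → ℂ} (hu : ContDiffOn ℝ 1 u unitDisc) (n : ℤ) {r : ℝ} (hr : |r| < 1) :
    fcoef n (fun z => z * dz u z + (-1) * ((starRingEnd ℂ) z * dzbar u z)) r
      = n * fcoef n u r := by
  have c1 : ContinuousOn (fun z => z * dz u z) unitDisc :=
    continuousOn_id.mul (continuousOn_dz hu)
  have c2 : ContinuousOn (fun z => (-1) * ((starRingEnd ℂ) z * dzbar u z)) unitDisc :=
    continuousOn_const.mul (Complex.continuous_conj.continuousOn.mul (continuousOn_dzbar hu))
  rw [fcoef_add c1 c2 n hr, fcoef_const_mul, fcoef_id_mul, fcoef_conj_mul, int_mul_fcoef hu n hr]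
  ring

lemma contDiff_conj : ContDiff ℝ 1 (fun z : ℂ => (starRingEnd ℂ) z) :=
  Complex.conjCLE.contDiff

/-- Two applications of `-i ∂_θ` to a C² function leave a continuous one, so `n²` times the `n`-th
coefficient is bounded on the circle. -/
lemma summable_fcoef {u : ℂ → ℂ} (hu : ContDiffOn ℝ 2 u unitDisc) {r : ℝ} (hr : |r| < 1) :
    Summable fun n : ℤ => fcoef n u r := by
  have hu1 : ContDiffOn ℝ 1 u unitDisc := hu.of_le (by norm_num)
  set v : ℂ → ℂ := fun z => z * dz u z + (-1) * ((starRingEnd ℂ) z * dzbar u z) with hv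
  have hv1 : ContDiffOn ℝ 1 v unitDisc :=
    (contDiffOn_id.mul (contDiffOn_dz (m := 1) (by exact_mod_cast hu))).add
      (contDiffOn_const.mul (contDiff_conj.contDiffOn.mul
        (contDiffOn_dzbar (m := 1) (by exact_mod_cast hu))))
  set w : ℂ → ℂ := fun z => z * dz v z + (-1) * ((starRingEnd ℂ) z * dzbar v z) with hw
  have hw1 : ContinuousOn w unitDisc :=
    (continuousOn_id.mul (continuousOn_dz hv1)).add
      (continuousOn_const.mul (Complex.continuous_conj.continuousOn.mul (continuousOn_dzbar hv1)))
  obtain ⟨C, hC⟩ := exists_bound_closedBall hw1 hr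
  have hb : ∀ n : ℤ, ‖(n : ℂ) ^ 2 * fcoef n u r‖ ≤ C := fun n => by
    have : (n : ℂ) ^ 2 * fcoef n u r = fcoef n w r := by
      rw [hw, fcoef_angular hv1 n hr, hv, fcoef_angular hu1 n hr]; ring
    rw [this]
    exact norm_fcoef_le n fun z hz => hC z hz.le
  refine Summable.of_norm_bounded_eventually
    ((Real.summable_one_div_int_pow (p := 2)).2 (by norm_num) |>.mul_left C) ?_
  refine (Set.finite_singleton (0 : ℤ)).subset fun n hn => ?_
  by_contra h0
  refine hn ?_
  have h0' : n ≠ 0 := h0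
  have h1 : (0 : ℝ) < (n : ℝ) ^ 2 := by positivity
  have h2 := hb n
  rw [norm_mul, norm_pow, Complex.norm_intCast, sq_abs] at h2
  change ‖fcoef n u r‖ ≤ C * (1 / (n : ℝ) ^ 2)
  rw [mul_one_div, le_div_iff₀ h1]; linarith

lemma hasSum_fcoef {u : ℂ → ℂ} (hu : ContDiffOn ℝ 2 u unitDisc) {r : ℝ} (hr : |r| < 1) (θ : ℝ) :
    HasSum (fun n : ℤ => fcoef n u r * Complex.exp (n * θ * Complex.I))
      (u (r * Complex.exp (θ * Complex.I))) := by
  have : Fact (0 < 2 * Real.pi) := ⟨Real.two_pi_pos⟩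
  have hcirc : ∀ x : ℝ, ((AddCircle.toCircle (x : AddCircle (2 * Real.pi)) : Circle) : ℂ) =
      Complex.exp (x * Complex.I) := fun x => by
    rw [AddCircle.toCircle_apply_mk, div_self Real.two_pi_pos.ne', one_mul, Circle.coe_exp]
  let f : C(AddCircle (2 * Real.pi), ℂ) :=
    ⟨fun x => u (r * (AddCircle.toCircle x : Circle)), by
      refine hu.continuousOn.comp_continuous ?_ fun x => ?_
      · exact continuous_const.mul (continuous_subtype_val.comp AddCircle.continuous_toCircle)
      · rw [unitDisc, mem_ball_zero_iff, norm_mul, Circle.norm_coe, mul_one, Complex.norm_real]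
        exact hr⟩
  have hfx : ∀ x : ℝ, f (x : AddCircle (2 * Real.pi)) = u (r * Complex.exp (x * Complex.I)) :=
    fun x => by
      change u _ = _
      rw [hcirc]
  have hfour : ∀ (n : ℤ) (x : ℝ), fourier n (x : AddCircle (2 * Real.pi)) =
      Complex.exp (n * x * Complex.I) := fun n x => by
    rw [fourier_coe_apply]
    congr 1
    have : (Real.pi : ℂ) ≠ 0 := by exact_mod_cast Real.pi_ne_zero
    push_cast; field_simp
  have hcoef : ∀ n, fourierCoeff f n = fcoef n u r := fun n => by
    rw [fourierCoeff_eq_intervalIntegral f n 0, fcoef, zero_add]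
    rw [Complex.real_smul]
    congr 1
    · push_cast; rw [one_div]
    · refine congrArg (fun h : ℝ → ℂ => ∫ θ in (0 : ℝ)..(2 * Real.pi), h θ) ?_
      ext1 x
      rw [hfour, hfx, smul_eq_mul, mul_comm]; congr 2; push_cast; ring
  have hs : Summable (fourierCoeff f) := (summable_fcoef hu hr).congr fun n => (hcoef n).symm
  have := has_pointwise_sum_fourier_series_of_summable hs (θ : AddCircle (2 * Real.pi))
  rw [hfx] at this
  refine this.congr_fun fun n => ?_
  rw [hcoef, hfour, smul_eq_mul]

lemma IsABHarmonic.exists_hasExpansion {a b : ℝ} {u : ℂ → ℂ} (hu : IsABHarmonic a b u) :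
    ∃ c, HasExpansion a b u c := by
  choose c hc using hu.exists_fcoef_eq
  refine ⟨c, fun z hz => ?_⟩
  have hz1 : ‖z‖ < 1 := by simpa [unitDisc] using hz
  have hr : |‖z‖| < 1 := by rwa [abs_norm]
  have hsum := hasSum_fcoef hu.1 hr z.arg
  have hze : (‖z‖ : ℂ) * Complex.exp (z.arg * Complex.I) = z := Complex.norm_mul_exp_arg_mul_I z
  have e1 : ∀ k : ℕ, posTerm a b c k z =
      fcoef (k : ℤ) u ‖z‖ * Complex.exp ((k : ℤ) * z.arg * Complex.I) := fun k => by
    conv_lhs => rw [← hze, posTerm_eq, ← hc k _ ⟨norm_nonneg z, hz1⟩]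
  have e2 : ∀ m : ℕ, negTerm a b c (m + 1) z =
      fcoef (Int.negSucc m) u ‖z‖ * Complex.exp ((Int.negSucc m : ℤ) * z.arg * Complex.I) :=
    fun m => by
      conv_lhs => rw [← hze, negTerm_eq, ← hc _ _ ⟨norm_nonneg z, hz1⟩]
  have s1 : Summable fun k : ℕ => posTerm a b c k z :=
    (hsum.summable.comp_injective Nat.cast_injective).congr fun k => (e1 k).symm
  have s2 : Summable fun m : ℕ => negTerm a b c (m + 1) z :=
    (hsum.summable.comp_injective (@Int.negSucc.inj)).congr fun m => (e2 m).symm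
  refine ⟨s1, s2, ?_⟩
  rw [hze] at hsum
  refine hsum.unique (HasSum.of_nat_of_neg_add_one (s1.hasSum.congr_fun fun k => (e1 k).symm)
    (s2.hasSum.congr_fun fun m => ?_))
  rw [e2, Int.negSucc_eq]

/-! ### Vanishing of the coefficients of index below `-α`. -/

/-- The coefficients of the expansion of index below `-a` vanish if one of the Wirtinger
derivatives belongs to `H_G^1`. -/
lemma HasExpansion.coeff_neg_eq_zero {a : ℕ} {b : ℝ} (hab : (a : ℝ) + b < 0) {u : ℂ → ℂ}
    (hu : ContDiffOn ℝ 1 u unitDisc) (hH : MemHG 1 (dz u) ∨ MemHG 1 (dzbar u))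
    {c : ℤ → ℂ} (h : HasExpansion a b u c) {n : ℕ} (hn : a < n) : c (-(n : ℤ)) = 0 := by
  obtain ⟨m, rfl⟩ : ∃ m, n = m + 1 := ⟨n - 1, by omega⟩
  change c (Int.negSucc m) = 0
  by_contra hc
  have ha0 : (0 : ℝ) ≤ a := a.cast_nonneg
  have hb : 0 < -b := by linarith
  have hm : (0 : ℝ) < ((m + 1 : ℕ) : ℝ) - a := sub_pos.2 (by exact_mod_cast hn)
  have hm1 : (1 : ℝ) ≤ ((m + 1 : ℕ) : ℝ) + 1 := by
    have : (0 : ℝ) ≤ ((m + 1 : ℕ) : ℝ) := Nat.cast_nonneg _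
    linarith
  set A := ordinaryHypergeometricCoefficient (-b) (((m + 1 : ℕ) : ℝ) - a)
    (((m + 1 : ℕ) : ℝ) + 1) with hA
  have hconv : ConvergesOnUnit A := convergesOnUnit_ordinaryHypergeometric _ _ (by linarith)
  have hpos : ∀ k, 0 < A k := ordinaryHypergeometricCoefficient_pos hb hm (by linarith)
  have hpos' : ∀ k, 0 ≤ derivCoeff A k := fun k =>
    mul_nonneg (by positivity) (hpos (k + 1)).le
  -- the Fourier coefficients of the two derivatives
  have hq : ∀ r ∈ Set.Ioo (0 : ℝ) 1, fcoef (Int.negSucc m + 1) (dzbar u) r =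
      c (Int.negSucc m) * radialSolBar a b (Int.negSucc m) r ∧
      fcoef (Int.negSucc m - 1) (dz u) r = c (Int.negSucc m) *
        (r ^ (m + 2) * powerSum (derivCoeff A) (r ^ 2) : ℝ) := by
    intro r hr
    have hr1 := abs_lt_one_of_mem_Ioo hr
    have hr0 : (r : ℂ) ≠ 0 := by exact_mod_cast hr.1.ne'
    -- The radial derivative gives the sum of the two derivative coefficients and `int_mul_fcoef`
    -- their difference, so each is known.
    have d1 := hasDerivAt_fcoef hu (Int.negSucc m) hr1
    have d2 := ((radialSystem_radialSol a b (Int.negSucc m) r hr).1).const_mul (c (Int.negSucc m))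
    have heq : fcoef (Int.negSucc m) u =ᶠ[𝓝 r]
        fun r => c (Int.negSucc m) * radialSol a b (Int.negSucc m) r := by
      filter_upwards [isOpen_Ioo.mem_nhds hr] with x hx
      exact h.fcoef_eq (abs_lt_one_of_mem_Ioo hx) _
    have hd := d1.unique (d2.congr_of_eventuallyEq heq)
    have hi := int_mul_fcoef hu (Int.negSucc m) hr1
    rw [h.fcoef_eq hr1] at hi
    have hi' : fcoef (Int.negSucc m - 1) (dz u) r = fcoef (Int.negSucc m + 1) (dzbar u) r +
        ((Int.negSucc m : ℤ) : ℂ) * (c (Int.negSucc m) * radialSol a b (Int.negSucc m) r) / r := by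
      rw [hi]; field_simp; ring
    rw [hi'] at hd
    have hq : fcoef (Int.negSucc m + 1) (dzbar u) r =
        c (Int.negSucc m) * radialSolBar a b (Int.negSucc m) r := by
      push_cast at hd
      linear_combination hd / 2
    refine ⟨hq, ?_⟩
    rw [hi', hq]
    simp only [radialSol, radialSolBar, ← hA]
    rw [Int.cast_negSucc]
    push_cast
    field_simp
    ring
  -- One bound serves both alternatives: the coefficient of `∂_z̄ u` differs from that of `∂_z u` by
  -- a term whose factor beside `c` is nonnegative.
  obtain ⟨B, hB⟩ : ∃ B, ∀ r ∈ Set.Ioo (0 : ℝ) 1, ‖c (Int.negSucc m)‖ *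
      (r ^ (m + 2) * powerSum (derivCoeff A) (r ^ 2)) ≤ B := by
    rcases hH with ⟨_, _, B, hB⟩ | ⟨_, _, B, hB⟩ <;> refine ⟨B, fun r hr => ?_⟩ <;>
      have hBr := hB ⟨r, hr, rfl⟩ <;>
      have hnn : 0 ≤ r ^ (m + 2) * powerSum (derivCoeff A) (r ^ 2) :=
        mul_nonneg (pow_nonneg hr.1.le _) (powerSum_nonneg hpos' (sq_nonneg r))
    · refine le_trans ?_ ((norm_fcoef_le_integralMean _ (Int.negSucc m - 1) r).trans hBr)
      rw [(hq r hr).2, norm_mul, Complex.norm_real, Real.norm_of_nonneg hnn]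
    · refine le_trans ?_ ((norm_fcoef_le_integralMean _ (Int.negSucc m + 1) r).trans hBr)
      rw [(hq r hr).1, norm_mul, Complex.norm_real]
      gcongr
      refine le_trans ?_ (le_abs_self _)
      simp only [radialSolBar]
      have := powerSum_nonneg (fun k => (hpos k).le) (sq_nonneg r)
      have h2 : 0 ≤ ((m : ℝ) + 1) * r ^ m * powerSum A (r ^ 2) :=
        mul_nonneg (mul_nonneg (by positivity) (pow_nonneg hr.1.le _)) this
      linarith
  have hc0 : 0 < ‖c (Int.negSucc m)‖ := norm_pos_iff.2 hc
  -- The upper parameters add up to `m + 1 - (a + b)`, at least the lower one minus 1. The factor `2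
  -- ^ (m + 2)` compensates `r ^ (m + 2)`, as `r` is taken above `1 / 2`.
  obtain ⟨x0, hx0, hx⟩ := not_bounded_powerSum_of_harmonic_le hconv.derivCoeff (hpos 1)
    (derivCoeff_hypergeometric_ge hb hm hm1 (by linarith)) (2 ^ (m + 2) * (|B| / ‖c (Int.negSucc m)‖))
  obtain ⟨r, hr, hr1⟩ := exists_between
    (max_lt (show (1 / 2 : ℝ) < 1 by norm_num) (by rw [Real.sqrt_lt' one_pos]; simpa using hx0.2 :
      √x0 < 1))
  have hr2 : 1 / 2 < r := (le_max_left _ _).trans_lt hr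
  have hrx : x0 < r ^ 2 := (Real.sqrt_lt' (by linarith)).1 ((le_max_right _ _).trans_lt hr)
  have hlt := hx (r ^ 2) ⟨hrx, by nlinarith⟩
  have hle := hB r ⟨by linarith, hr1⟩
  have hpow : (1 / 2 : ℝ) ^ (m + 2) ≤ r ^ (m + 2) := by gcongr
  have h1 : |B| / ‖c (Int.negSucc m)‖ < r ^ (m + 2) * powerSum (derivCoeff A) (r ^ 2) := by
    calc |B| / ‖c (Int.negSucc m)‖
        = (1 / 2) ^ (m + 2) * (2 ^ (m + 2) * (|B| / ‖c (Int.negSucc m)‖)) := by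
          rw [← mul_assoc, ← mul_pow]; norm_num
      _ < (1 / 2) ^ (m + 2) * powerSum (derivCoeff A) (r ^ 2) := by gcongr
      _ ≤ _ := by
        gcongr
        exact powerSum_nonneg hpos' (sq_nonneg r)
  rw [div_lt_iff₀' hc0] at h1
  exact absurd (h1.trans_le hle) (not_lt.2 (le_abs_self B))

/-! ### Polyanalytic functions are polyharmonic. -/

/-- `w` is, on the unit disc, a polynomial in `z̄` of degree less than `n` with analytic
coefficients. -/
def IsPolyanalytic (n : ℕ) (w : ℂ → ℂ) : Prop :=
  ∃ F : ℕ → ℂ → ℂ, (∀ j, AnalyticOnNhd ℂ (F j) unitDisc) ∧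
    ∀ z ∈ unitDisc, w z = ∑ j ∈ Finset.range n, F j z * (starRingEnd ℂ) z ^ j

lemma IsPolyanalytic.zero (n : ℕ) : IsPolyanalytic n (fun _ => 0) :=
  ⟨fun _ _ => 0, fun _ => analyticOnNhd_const, fun z _ => by simp⟩

lemma IsPolyanalytic.add {n : ℕ} {v w : ℂ → ℂ} (hv : IsPolyanalytic n v)
    (hw : IsPolyanalytic n w) : IsPolyanalytic n (fun z => v z + w z) := by
  obtain ⟨F, hF, hv⟩ := hv
  obtain ⟨G, hG, hw⟩ := hw
  refine ⟨fun j z => F j z + G j z, fun j => (hF j).add (hG j), fun z hz => ?_⟩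
  dsimp only
  rw [hv z hz, hw z hz, ← Finset.sum_add_distrib]
  exact Finset.sum_congr rfl fun j _ => by ring

lemma IsPolyanalytic.sum {ι : Type*} {n : ℕ} {v : ι → ℂ → ℂ} (s : Finset ι)
    (h : ∀ i ∈ s, IsPolyanalytic n (v i)) : IsPolyanalytic n (fun z => ∑ i ∈ s, v i z) := by
  classical
  induction s using Finset.induction_on with
  | empty => simpa using IsPolyanalytic.zero n
  | insert i s hi ih =>
    simp only [Finset.sum_insert hi]
    exact (h i (Finset.mem_insert_self i s)).add (ih fun j hj => h j (Finset.mem_insert_of_mem hj))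

lemma IsPolyanalytic.single {n j : ℕ} (hj : j < n) {F : ℂ → ℂ} (hF : AnalyticOnNhd ℂ F unitDisc) :
    IsPolyanalytic n (fun z => F z * (starRingEnd ℂ) z ^ j) := by
  refine ⟨fun i z => if i = j then F z else 0, fun i => ?_, fun z _ => ?_⟩
  · by_cases h : i = j
    · simpa [h] using hF
    · simpa [h] using analyticOnNhd_const
  · simp [ite_mul, hj]

lemma contDiffOn_mul_conj_pow {F : ℂ → ℂ} (hF : AnalyticOnNhd ℂ F unitDisc) (j m : ℕ) :
    ContDiffOn ℝ m (fun z => F z * (starRingEnd ℂ) z ^ j) unitDisc := by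
  have h1 : ContDiffOn ℂ m F unitDisc := hF.contDiffOn isOpen_unitDisc.uniqueDiffOn
  have h2 : ContDiff ℝ m (fun z : ℂ => (starRingEnd ℂ) z) := Complex.conjCLE.contDiff
  exact (h1.restrict_scalars ℝ).mul (h2.pow j).contDiffOn

lemma IsPolyanalytic.contDiffOn {n : ℕ} {w : ℂ → ℂ} (hw : IsPolyanalytic n w) (m : ℕ) :
    ContDiffOn ℝ m w unitDisc := by
  obtain ⟨F, hF, h⟩ := hw
  exact (ContDiffOn.sum fun j _ => contDiffOn_mul_conj_pow (hF j) j m).congr h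

lemma fderiv_mul_conj_pow {F : ℂ → ℂ} (hF : AnalyticOnNhd ℂ F unitDisc) (j : ℕ) {z : ℂ}
    (hz : z ∈ unitDisc) (w : ℂ) :
    fderiv ℝ (fun z => F z * (starRingEnd ℂ) z ^ j) z w =
      w * (deriv F z * (starRingEnd ℂ) z ^ j)
        + (starRingEnd ℂ) w * (j * (F z * (starRingEnd ℂ) z ^ (j - 1))) := by
  have h1 : HasFDerivAt F ((ContinuousLinearMap.toSpanSingleton ℂ (deriv F z)).restrictScalars ℝ)
      z := (hF z hz).differentiableAt.hasDerivAt.hasFDerivAt.restrictScalars ℝ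
  have h2 : HasFDerivAt (fun z : ℂ => (starRingEnd ℂ) z) (Complex.conjCLE : ℂ →L[ℝ] ℂ) z :=
    Complex.conjCLE.hasFDerivAt
  have h3 := (h1.mul (h2.pow j)).fderiv
  change fderiv ℝ (fun z => F z * (starRingEnd ℂ) z ^ j) z = _ at h3
  rw [h3]
  simp
  ring

/-- In the sum of the second derivatives along `1` and `i`, the terms with `w²` and `w̄²` cancel and
the mixed ones add up. For `j = 0` the truncated exponent is harmless, the factor `j` being 0. -/
lemma laplacian_mul_conj_pow {F : ℂ → ℂ} (hF : AnalyticOnNhd ℂ F unitDisc) (j : ℕ) {z : ℂ}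
    (hz : z ∈ unitDisc) :
    Laplacian.laplacian (fun z => F z * (starRingEnd ℂ) z ^ j) z =
      4 * j * deriv F z * (starRingEnd ℂ) z ^ (j - 1) := by
  have hF1 : AnalyticOnNhd ℂ (deriv F) unitDisc := hF.deriv
  set T := fun z => F z * (starRingEnd ℂ) z ^ j with hT
  have hd : DifferentiableAt ℝ (fderiv ℝ T) z :=
    (((contDiffOn_mul_conj_pow hF j 2).fderiv_of_isOpen (m := 1) isOpen_unitDisc
      (by norm_num)).differentiableOn one_ne_zero).differentiableAt (isOpen_unitDisc.mem_nhds hz)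
  have d1 : DifferentiableAt ℝ (fun z => deriv F z * (starRingEnd ℂ) z ^ j) z :=
    ((contDiffOn_mul_conj_pow hF1 j 1).differentiableOn (by norm_num)).differentiableAt
      (isOpen_unitDisc.mem_nhds hz)
  have d2 : DifferentiableAt ℝ (fun z => F z * (starRingEnd ℂ) z ^ (j - 1)) z :=
    ((contDiffOn_mul_conj_pow hF (j - 1) 1).differentiableOn (by norm_num)).differentiableAt
      (isOpen_unitDisc.mem_nhds hz)
  have second : ∀ w : ℂ, iteratedFDeriv ℝ 2 T z ![w, w] =
      w * (w * (deriv (deriv F) z * (starRingEnd ℂ) z ^ j)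
        + (starRingEnd ℂ) w * (j * (deriv F z * (starRingEnd ℂ) z ^ (j - 1))))
      + (starRingEnd ℂ) w * (j * (w * (deriv F z * (starRingEnd ℂ) z ^ (j - 1))
        + (starRingEnd ℂ) w * ((j - 1 : ℕ) * (F z * (starRingEnd ℂ) z ^ (j - 1 - 1))))) := by
    intro w
    rw [iteratedFDeriv_two_apply]
    simp only [Matrix.cons_val_zero, Matrix.cons_val_one]
    have e1 : fderiv ℝ (fderiv ℝ T) z w w = fderiv ℝ (fun y => fderiv ℝ T y w) z w := by
      rw [fderiv_clm_apply hd (by fun_prop)]; simp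
    have e2 : (fun y => fderiv ℝ T y w) =ᶠ[𝓝 z] fun z =>
        w * (deriv F z * (starRingEnd ℂ) z ^ j)
        + (starRingEnd ℂ) w * (j * (F z * (starRingEnd ℂ) z ^ (j - 1))) := by
      filter_upwards [isOpen_unitDisc.mem_nhds hz] with y hy
      exact fderiv_mul_conj_pow hF j hy w
    rw [e1, e2.fderiv_eq, fderiv_fun_add (d1.const_mul _) ((d2.const_mul _).const_mul _),
      fderiv_const_mul d1, fderiv_const_mul (d2.const_mul _), fderiv_const_mul d2]
    simp only [add_apply, smul_apply, smul_eq_mul]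
    rw [fderiv_mul_conj_pow hF1 j hz, fderiv_mul_conj_pow hF (j - 1) hz]
  rw [InnerProductSpace.laplacian_eq_iteratedFDeriv_complexPlane]
  simp only [second, map_one, Complex.conj_I]
  linear_combination (deriv (deriv F) z * (starRingEnd ℂ) z ^ j
    + (j * ((j - 1 : ℕ) * (F z * (starRingEnd ℂ) z ^ (j - 1 - 1))))
    - 2 * (j * (deriv F z * (starRingEnd ℂ) z ^ (j - 1)))) * Complex.I_mul_I

lemma laplacian_sum {n : ℕ} {v : ℕ → ℂ → ℂ} {z : ℂ} (h : ∀ i, ContDiffAt ℝ 2 (v i) z) :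
    Laplacian.laplacian (fun z => ∑ i ∈ Finset.range n, v i z) z =
      ∑ i ∈ Finset.range n, Laplacian.laplacian (v i) z := by
  induction n with
  | zero => simp
  | succ n ih =>
    simp only [Finset.sum_range_succ]
    rw [← ih]
    exact ContDiffAt.laplacian_add (ContDiffAt.sum fun i _ => h i) (h n)

lemma IsPolyanalytic.laplacian {n : ℕ} {w : ℂ → ℂ} (hw : IsPolyanalytic (n + 1) w) :
    IsPolyanalytic n (Laplacian.laplacian w) := by
  obtain ⟨F, hF, h⟩ := hw
  refine ⟨fun j z => 4 * (j + 1) * deriv (F (j + 1)) z,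
    fun j => analyticOnNhd_const.mul (hF (j + 1)).deriv, fun z hz => ?_⟩
  have e : w =ᶠ[𝓝 z] fun z => ∑ j ∈ Finset.range (n + 1), F j z * (starRingEnd ℂ) z ^ j := by
    filter_upwards [isOpen_unitDisc.mem_nhds hz] with y hy
    exact h y hy
  rw [(InnerProductSpace.laplacian_congr_nhds e).eq_of_nhds, laplacian_sum fun j =>
    (contDiffOn_mul_conj_pow (hF j) j 2).contDiffAt (isOpen_unitDisc.mem_nhds hz)]
  simp only [laplacian_mul_conj_pow (hF _) _ hz]
  rw [Finset.sum_range_succ']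
  simp

lemma IsPolyanalytic.iterate_laplacian_eq_zero {n : ℕ} {w : ℂ → ℂ} (hw : IsPolyanalytic n w) :
    ∀ z ∈ unitDisc, ((fun w : ℂ → ℂ => Laplacian.laplacian w)^[n] w) z = 0 := by
  induction n generalizing w with
  | zero =>
    obtain ⟨F, -, h⟩ := hw
    simpa using h
  | succ n ih =>
    rw [Function.iterate_succ_apply]
    exact ih hw.laplacian

lemma IsPolyanalytic.isPolyharmonic {n : ℕ} {w : ℂ → ℂ} (hw : IsPolyanalytic n w) :
    IsPolyharmonic n w :=
  ⟨hw.contDiffOn _, hw.iterate_laplacian_eq_zero⟩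

/-! ### Terminating factors and rearrangement by powers of `|z|²`. -/

lemma ordinaryHypergeometricCoefficient_neg_nat_eq_zero {a n : ℕ} (hn : a < n) (b c : ℝ) :
    ordinaryHypergeometricCoefficient (-(a : ℝ)) b c n = 0 := by
  have : (ascPochhammer ℝ n).eval (-(a : ℝ)) = 0 :=
    (ascPochhammer_eval_eq_zero_iff n _).2 ⟨a, hn, by simp⟩
  simp [ordinaryHypergeometricCoefficient, this]

lemma ordinaryHypergeometricCoefficient_symm (a b c : ℝ) (n : ℕ) :
    ordinaryHypergeometricCoefficient a b c n = ordinaryHypergeometricCoefficient b a c n := by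
  simp only [ordinaryHypergeometricCoefficient]; ring

lemma powerSum_eq_sum_range {A : ℕ → ℝ} {a : ℕ} (h : ∀ n, a < n → A n = 0) (x : ℝ) :
    powerSum A x = ∑ i ∈ Finset.range (a + 1), A i * x ^ i :=
  tsum_eq_sum fun n hn => by
    rw [h n (by simpa [Nat.lt_succ_iff] using hn), zero_mul]

lemma tendsto_ascPochhammer_div (b : ℝ) (i : ℕ) :
    Tendsto (fun k : ℕ => (ascPochhammer ℝ i).eval ((k : ℝ) - b)
      * ((ascPochhammer ℝ i).eval ((k : ℝ) + 1))⁻¹) atTop (𝓝 1) := by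
  induction i with
  | zero => simp
  | succ i ih =>
    have h := tendsto_add_mul_div_add_mul_atTop_nhds (-b + i : ℝ) (1 + i : ℝ) 1 one_ne_zero
    have := ih.mul h
    rw [div_one, mul_one] at this
    refine this.congr fun k => ?_
    rw [ascPochhammer_succ_eval, ascPochhammer_succ_eval, mul_inv, div_eq_mul_inv]
    ring_nf

lemma tendsto_ordinaryHypergeometricCoefficient (a b : ℝ) (i : ℕ) :
    Tendsto (fun k : ℕ => ordinaryHypergeometricCoefficient a ((k : ℝ) - b) ((k : ℝ) + 1) i) atTop
      (𝓝 ((i.factorial : ℝ)⁻¹ * (ascPochhammer ℝ i).eval a)) := by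
  have := (tendsto_ascPochhammer_div b i).const_mul ((i.factorial : ℝ)⁻¹ * (ascPochhammer ℝ i).eval a)
  rw [mul_one] at this
  refine this.congr fun k => ?_
  simp only [ordinaryHypergeometricCoefficient]; ring

/-- The binomial theorem, since `(-a)_i / i! = (-1)^i C(a, i)`. -/
lemma sum_ascPochhammer_neg_nat (a : ℕ) (x : ℝ) :
    ∑ i ∈ Finset.range (a + 1), (i.factorial : ℝ)⁻¹ * (ascPochhammer ℝ i).eval (-(a : ℝ)) * x ^ i
      = (1 - x) ^ a := by
  rw [show (1 - x : ℝ) = -x + 1 by ring, add_pow]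
  refine Finset.sum_congr rfl fun i _ => ?_
  rw [ascPochhammer_eval_neg_eq_descPochhammer, descPochhammer_eval_eq_descFactorial,
    Nat.descFactorial_eq_factorial_mul_choose]
  have : (i.factorial : ℝ) ≠ 0 := by positivity
  have h2 : (-x) ^ i = (-1) ^ i * x ^ i := neg_pow x i
  push_cast
  field_simp
  rw [h2]; simp; ring

/-- The sum has `a + 1` terms for every `k`, and `(k-b)_i / (k+1)_i` tends to 1 in each. -/
lemma tendsto_powerSum_hypergeometric (a : ℕ) (b x : ℝ) :
    Tendsto (fun k : ℕ => powerSum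
      (ordinaryHypergeometricCoefficient (-(a : ℝ)) ((k : ℝ) - b) ((k : ℝ) + 1)) x) atTop
      (𝓝 ((1 - x) ^ a)) := by
  rw [← sum_ascPochhammer_neg_nat]
  refine (tendsto_finsetSum _ fun i _ =>
    (tendsto_ordinaryHypergeometricCoefficient (-(a : ℝ)) b i).mul_const (x ^ i)).congr fun k => ?_
  rw [powerSum_eq_sum_range fun n hn => ordinaryHypergeometricCoefficient_neg_nat_eq_zero hn _ _]

/-- The coefficient of `|z|^{2i} z^k` in the expansion. -/
noncomputable def posCoeff (a : ℕ) (b : ℝ) (c : ℤ → ℂ) (i k : ℕ) : ℂ :=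
  c k * ordinaryHypergeometricCoefficient (-(a : ℝ)) ((k : ℝ) - b) ((k : ℝ) + 1) i

/-- The analytic series obtained by picking the `i`-th coefficient of each hypergeometric factor
converges on the disc. -/
lemma HasExpansion.summable_coeff {a : ℕ} {b : ℝ} {u : ℂ → ℂ} {c : ℤ → ℂ}
    (h : HasExpansion a b u c) (i : ℕ) {ρ : ℝ} (hρ : ρ ∈ Set.Ioo (0 : ℝ) 1) :
    Summable fun k : ℕ => ‖posCoeff a b c i k‖ * ρ ^ k := by
  set P : ℕ → ℝ := fun k => powerSum
    (ordinaryHypergeometricCoefficient (-(a : ℝ)) ((k : ℝ) - b) ((k : ℝ) + 1)) (ρ ^ 2) with hP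
  have hs : Summable fun k : ℕ => ‖c k * P k * (ρ : ℂ) ^ k‖ := by
    have h1 := (h ρ (by simpa using ofReal_mul_exp_mem_unitDisc (abs_lt_one_of_mem_Ioo hρ) 0)).1.norm
    refine h1.congr fun k => ?_
    rw [posTerm, ordinaryHypergeometric_eq_powerSum, Complex.norm_real, Real.norm_eq_abs, sq_abs]
  -- Each summand is the norm of the known summable term times the norm of (`i`-th coefficient) / `P
  -- k`. This ratio converges, hence is bounded, because the limit of `P k` is not 0.
  have hne : (1 - ρ ^ 2) ^ a ≠ 0 := pow_ne_zero _ (one_sub_sq_pos hρ).ne'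
  have hPlim := tendsto_powerSum_hypergeometric a b (ρ ^ 2)
  have hratio := (tendsto_ordinaryHypergeometricCoefficient (-(a : ℝ)) b i).div hPlim hne
  have hO := hratio.isBigO_one ℝ
  refine summable_of_isBigO_nat hs ?_
  have h2 : (fun k : ℕ => ‖c k * P k * (ρ : ℂ) ^ k‖ * (ordinaryHypergeometricCoefficient (-(a : ℝ))
      ((k : ℝ) - b) ((k : ℝ) + 1) i / P k)) =O[atTop] fun k : ℕ => ‖c k * P k * (ρ : ℂ) ^ k‖ := by
    simpa using (Asymptotics.isBigO_refl (fun k : ℕ => ‖c k * P k * (ρ : ℂ) ^ k‖) atTop).mul hO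
  refine Asymptotics.IsBigO.trans (Asymptotics.IsBigO.of_norm_eventuallyLE ?_) h2.norm_left
  filter_upwards [hPlim.eventually_ne hne] with k hk
  have hk : P k ≠ 0 := hk
  simp only [posCoeff, norm_mul, norm_div, norm_norm, norm_pow, Complex.norm_real]
  have : ‖P k‖ ≠ 0 := norm_ne_zero_iff.2 hk
  apply le_of_eq
  field_simp

/-- A power series with coefficients summable on every circle is analytic on the disc. -/
lemma analyticOnNhd_tsum_pow {d : ℕ → ℂ}
    (hd : ∀ ρ ∈ Set.Ioo (0 : ℝ) 1, Summable fun k => ‖d k‖ * ρ ^ k) :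
    AnalyticOnNhd ℂ (fun z => ∑' k, d k * z ^ k) unitDisc := by
  intro z hz
  have hz1 : ‖z‖ < 1 := by simpa [unitDisc] using hz
  obtain ⟨ρ, hzρ, hρ⟩ := exists_between hz1
  have h0 : 0 < ρ := (norm_nonneg z).trans_lt hzρ
  have hdiff : DifferentiableOn ℂ (fun z => ∑' k, d k * z ^ k) (Metric.ball 0 ρ) := by
    refine Complex.differentiableOn_tsum_of_summable_norm (hd ρ ⟨h0, hρ⟩)
      (fun k => by fun_prop) Metric.isOpen_ball fun k w hw => ?_
    rw [norm_mul, norm_pow]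
    have : ‖w‖ ≤ ρ := (mem_ball_zero_iff.1 hw).le
    gcongr
  exact hdiff.analyticAt (Metric.isOpen_ball.mem_nhds (by simpa using hzρ))

lemma summable_mul_pow_of_mem_unitDisc {d : ℕ → ℂ}
    (hd : ∀ ρ ∈ Set.Ioo (0 : ℝ) 1, Summable fun k => ‖d k‖ * ρ ^ k) {z : ℂ} (hz : z ∈ unitDisc) :
    Summable fun k => d k * z ^ k := by
  have hz1 : ‖z‖ < 1 := by simpa [unitDisc] using hz
  obtain ⟨ρ, hzρ, hρ⟩ := exists_between hz1
  have h0 : 0 < ρ := (norm_nonneg z).trans_lt hzρ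
  refine Summable.of_norm_bounded (hd ρ ⟨h0, hρ⟩) fun k => ?_
  rw [norm_mul, norm_pow]
  gcongr

/-- The coefficient of `|z|^{2i} z̄^{m + 1}` in the expansion. -/
noncomputable def negCoeff (a : ℕ) (b : ℝ) (c : ℤ → ℂ) (i m : ℕ) : ℂ :=
  c (-((m + 1 : ℕ) : ℤ)) * ordinaryHypergeometricCoefficient (-b) (((m + 1 : ℕ) : ℝ) - a)
    (((m + 1 : ℕ) : ℝ) + 1) i

/-- The factor of `z̄ ^ (m + 1)` is a polynomial of degree at most `a - (m + 1)`. This keeps the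
exponent `m + 1 + i` of `z̄` at most `a` and removes the antianalytic part of the top coefficient.
-/
lemma negCoeff_eq_zero {a : ℕ} (b : ℝ) (c : ℤ → ℂ) {i m : ℕ} (hm : m < a) (hi : a ≤ m + i) :
    negCoeff a b c i m = 0 := by
  have e : ((m + 1 : ℕ) : ℝ) - a = -((a - (m + 1) : ℕ) : ℝ) := by
    rw [Nat.cast_sub hm]; ring
  rw [negCoeff, e, ordinaryHypergeometricCoefficient_symm,
    ordinaryHypergeometricCoefficient_neg_nat_eq_zero (by omega)]
  simp

lemma HasExpansion.eq_sum {a : ℕ} {b : ℝ} {u : ℂ → ℂ} {c : ℤ → ℂ} (h : HasExpansion a b u c)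
    (hc : ∀ n : ℕ, a < n → c (-(n : ℤ)) = 0) {z : ℂ} (hz : z ∈ unitDisc) :
    u z = ∑ i ∈ Finset.range (a + 1), ((∑' k, posCoeff a b c i k * z ^ k)
      + ∑ m ∈ Finset.range a, negCoeff a b c i m * (starRingEnd ℂ) z ^ (m + 1))
        * (‖z‖ : ℂ) ^ (2 * i) := by
  have e1 : ∀ k : ℕ, posTerm a b c k z = ∑ i ∈ Finset.range (a + 1),
      posCoeff a b c i k * z ^ k * (‖z‖ : ℂ) ^ (2 * i) := fun k => by
    rw [posTerm, ordinaryHypergeometric_eq_powerSum, powerSum_eq_sum_range fun n hn =>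
      ordinaryHypergeometricCoefficient_neg_nat_eq_zero hn _ _, Complex.ofReal_sum,
      Finset.mul_sum, Finset.sum_mul]
    refine Finset.sum_congr rfl fun i _ => ?_
    simp only [posCoeff]
    push_cast
    rw [pow_mul]; ring
  have e2 : ∀ m < a, negTerm a b c (m + 1) z = ∑ i ∈ Finset.range (a + 1),
      negCoeff a b c i m * (starRingEnd ℂ) z ^ (m + 1) * (‖z‖ : ℂ) ^ (2 * i) := fun m hm => by
    have hA : ∀ n, a < n → ordinaryHypergeometricCoefficient (-b) (((m + 1 : ℕ) : ℝ) - a)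
        (((m + 1 : ℕ) : ℝ) + 1) n = 0 := fun n hn => by
      rw [show ((m + 1 : ℕ) : ℝ) - a = -((a - (m + 1) : ℕ) : ℝ) by rw [Nat.cast_sub hm]; ring,
        ordinaryHypergeometricCoefficient_symm,
        ordinaryHypergeometricCoefficient_neg_nat_eq_zero (by omega)]
    rw [negTerm, ordinaryHypergeometric_eq_powerSum, powerSum_eq_sum_range hA, Complex.ofReal_sum,
      Finset.mul_sum, Finset.sum_mul]
    refine Finset.sum_congr rfl fun i _ => ?_
    simp only [negCoeff]
    push_cast
    rw [pow_mul]; ring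
  have s1 : ∑' k, posTerm a b c k z = ∑ i ∈ Finset.range (a + 1),
      (∑' k, posCoeff a b c i k * z ^ k) * (‖z‖ : ℂ) ^ (2 * i) := by
    simp_rw [e1]
    rw [Summable.tsum_finsetSum fun i _ => (summable_mul_pow_of_mem_unitDisc
      (fun ρ hρ => h.summable_coeff i hρ) hz).mul_right _]
    exact Finset.sum_congr rfl fun i _ => tsum_mul_right
  have s2 : ∑' m, negTerm a b c (m + 1) z = ∑ m ∈ Finset.range a, negTerm a b c (m + 1) z :=
    tsum_eq_sum fun m hm => by
      rw [negTerm, hc (m + 1) (by simpa [Nat.lt_succ_iff] using hm)]; simp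
  rw [(h z hz).2.2, s1, s2, Finset.sum_congr rfl fun m hm => e2 m (Finset.mem_range.1 hm),
    Finset.sum_comm, ← Finset.sum_add_distrib]
  refine Finset.sum_congr rfl fun i _ => ?_
  rw [add_mul, Finset.sum_mul]

lemma ofReal_norm_pow_two_mul (z : ℂ) (i : ℕ) :
    (‖z‖ : ℂ) ^ (2 * i) = z ^ i * (starRingEnd ℂ) z ^ i := by
  rw [pow_mul, ← Complex.mul_conj', mul_pow]

lemma HasExpansion.isPolyanalytic {a : ℕ} {b : ℝ} {u : ℂ → ℂ} {c : ℤ → ℂ}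
    (h : HasExpansion a b u c) (hc : ∀ n : ℕ, a < n → c (-(n : ℤ)) = 0) :
    IsPolyanalytic (a + 1) u := by
  have key : IsPolyanalytic (a + 1) fun z => ∑ i ∈ Finset.range (a + 1),
      ((((∑' k, posCoeff a b c i k * z ^ k) * z ^ i) * (starRingEnd ℂ) z ^ i)
      + ∑ m ∈ Finset.range a, (negCoeff a b c i m * z ^ i) * (starRingEnd ℂ) z ^ (m + 1 + i)) := by
    refine IsPolyanalytic.sum _ fun i hi => IsPolyanalytic.add
      (IsPolyanalytic.single (Finset.mem_range.1 hi) ?_) (IsPolyanalytic.sum _ fun m hm => ?_)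
    · exact (analyticOnNhd_tsum_pow fun ρ hρ => h.summable_coeff i hρ).mul (analyticOnNhd_id.pow i)
    · by_cases him : m + i < a
      · exact IsPolyanalytic.single (by omega) (analyticOnNhd_const.mul (analyticOnNhd_id.pow i))
      -- The monomials of degree above `a` in `z̄` have coefficient 0.
      · rw [negCoeff_eq_zero b c (Finset.mem_range.1 hm) (not_lt.1 him)]
        simpa using IsPolyanalytic.zero (a + 1)
  obtain ⟨F, hF, hFu⟩ := key
  refine ⟨F, hF, fun z hz => ?_⟩
  rw [← hFu z hz, h.eq_sum hc hz]
  refine Finset.sum_congr rfl fun i _ => ?_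
  rw [ofReal_norm_pow_two_mul, add_mul, Finset.sum_mul]
  congr 1
  · ring
  · exact Finset.sum_congr rfl fun m _ => by ring

theorem mainTheorem4 (α : ℕ) (hα : 0 < α) (β : ℝ)
    (hlow : -1 < (α : ℝ) + β) (hupp : (α : ℝ) + β < 0)
    (u : ℂ → ℂ) (hu : IsABHarmonic (α : ℝ) β u)
    (hH : MemHG 1 (dz u) ∨ MemHG 1 (dzbar u)) :
    (∃ c : ℤ → ℂ, HasExpansion (α : ℝ) β u c) ∧
    (∀ c : ℤ → ℂ, HasExpansion (α : ℝ) β u c → ∀ n : ℕ, α < n → c (-(n : ℤ)) = 0) ∧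
    IsPolyharmonic (α + 1) u ∧
    (∃ K : ℕ → ℂ → ℂ,
      (∀ z ∈ unitDisc,
        u z = ∑ i ∈ Finset.range (α + 1), K i z * ((‖z‖ : ℂ) ^ (2 * i))) ∧
      (∀ i < α, ∃ (h : ℂ → ℂ) (g : Polynomial ℂ), AnalyticOnNhd ℂ h unitDisc ∧
        ∀ z ∈ unitDisc, K i z = h z + (starRingEnd ℂ) (g.eval z)) ∧
      AnalyticOnNhd ℂ (K α) unitDisc) := by
  have hvanish : ∀ c : ℤ → ℂ, HasExpansion (α : ℝ) β u c → ∀ n : ℕ, α < n → c (-(n : ℤ)) = 0 :=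
    fun c hc n hn => hc.coeff_neg_eq_zero hupp hu.contDiffOn_one hH hn
  obtain ⟨c, hc⟩ := hu.exists_hasExpansion
  refine ⟨⟨c, hc⟩, hvanish, (hc.isPolyanalytic (hvanish c hc)).isPolyharmonic,
    fun i z => (∑' k, posCoeff α β c i k * z ^ k)
      + ∑ m ∈ Finset.range α, negCoeff α β c i m * (starRingEnd ℂ) z ^ (m + 1),
    fun z hz => hc.eq_sum (hvanish c hc) hz, fun i _ => ⟨fun z => ∑' k, posCoeff α β c i k * z ^ k,
      -- The coefficients are conjugated because `g` enters through its conjugate.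
      ∑ m ∈ Finset.range α, Polynomial.C ((starRingEnd ℂ) (negCoeff α β c i m)) * Polynomial.X ^ (m + 1),
      analyticOnNhd_tsum_pow fun ρ hρ => hc.summable_coeff i hρ, fun z _ => ?_⟩, ?_⟩
  · simp [Polynomial.eval_finsetSum]
  · have : (fun z : ℂ => (∑' k, posCoeff α β c α k * z ^ k)
        + ∑ m ∈ Finset.range α, negCoeff α β c α m * (starRingEnd ℂ) z ^ (m + 1)) =
        fun z => ∑' k, posCoeff α β c α k * z ^ k := by
      ext1 z
      rw [Finset.sum_eq_zero fun m hm => by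
        rw [negCoeff_eq_zero β c (Finset.mem_range.1 hm) (by omega), zero_mul], add_zero]
    change AnalyticOnNhd ℂ (fun z : ℂ => _) unitDisc
    rw [this]
    exact analyticOnNhd_tsum_pow fun ρ hρ => hc.summable_coeff α hρ
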